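/- Let $E=(E^0,E^1,r,s)$ be a finite directed graph (loops and multiple edges are allowed a priori) with no directed cycles, and let $k\ge 1$ be an integer. Let $C^*(E)$ be the universal $C^*$-algebra generated by mutually orthogonal projections $P_v$ ($v\in E^0$) and partial isometries $S_e$ ($e\in E^1$) with mutually orthogonal ranges such that $S_e^*S_e=P_{r(e)}$, $S_eS_e^*\le P_{s(e)}$, and $P_v=\sum_{s(e)=v}S_eS_e^*$ whenever $s^{-1}(v)$ is nonempty. Let $\mathbb Z/k$ act on $C^*(E)$ by the gauge action, in which the class of $m$ acts by the automorphism $P_v\mapsto P_v$, $S_e\mapsto e^{2\pi i m/k}S_e$. For a sink $v$ (a vertex with $s^{-1}(v)=\emptyset$) and a residue $i$ modulo $k$, let $\#^v_i$ be the number of directed paths in $E$, including the path of length $0$ at $v$, that end at $v$ and have length congruent to $i$ modulo $k$. For an action of a compact group $G$ on a unital $C^*$-algebra $A$, the plain local-triviality dimension $\dim_{\mathrm{LT}}^{G}(A)$ is the smallest $n\ge 0$ for which there are $G$-equivariant $*$-homomorphisms $\rho_0,\dots,\rho_n:C_0((0,1])\otimes C(G)\to A$ with $\sum_{i=0}^n\rho_i(t\otimes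 1)=1$, where $t$ is the identity function on $(0,1]$ and $G$ acts on $C(G)$ by translation and trivially on $C_0((0,1])$. The strong local-triviality dimension $\dim_{\mathrm{SLT}}^{G}(A)$ is the smallest $n\ge 0$ for which there is a $G$-equivariant unital $*$-homomorphism $C(E_nG)\to A$, where $E_0G=G$, $E_{n+1}G=E_nG*G$ is the topological join, and $G$ acts diagonally. Each dimension is $\infty$ if no such $n$ exists. Then the following are equivalent: (a) $\dim_{\mathrm{SLT}}^{\mathbb Z/k}(C^*(E))$ is finite; (b) $\dim_{\mathrm{LT}}^{\mathbb Z/k}(C^*(E))$ is finite; (c) for each sink $v$ of $E$, the number $\#^v_i$ is independent of $i$; (d) $\dim_{\mathrm{LT}}^{\mathbb Z/k}(C^*(E))=0$. In particular, each of $\dim_{\mathrm{SLT}}^{\mathbb Z/k}(C^*(E))$ and $\dim_{\mathrm{LT}}^{\mathbb Z/k}(C^*(E))$ is either $0$ or $\infty$. -/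

import Mathlib

open scoped ENNReal ZeroAtInfty Topology

universe u v w

/-! ### Directed graphs, paths and sinks -/

/-- A directed graph with vertex set `V` and edge set `Ed`, given by its source and range maps.
Loops and multiple edges are allowed. -/
structure DirectedGraph (V : Type u) (Ed : Type v) where
  /-- the source map -/
  s : Ed → V
  /-- the range map -/
  r : Ed → V

namespace DirectedGraph

variable {V : Type u} {Ed : Type v}

/-- `E.IsPath a l b`: the list of edges `l = [e₁, …, eₙ]` is a directed path `e₁ ⋯ eₙ`
from the vertex `a` to the vertex `b`, that is `s e₁ = a`, `r eⱼ = s eⱼ₊₁` and `r eₙ = b`.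
The empty list is the path of length `0` at `a`, for `a = b`. -/
def IsPath (E : DirectedGraph V Ed) : V → List Ed → V → Prop
  | a, [], b => a = b
  | a, e :: l, b => E.s e = a ∧ E.IsPath (E.r e) l b

/-- There are no directed cycles: the only path from a vertex to itself has length `0`. -/
def IsAcyclic (E : DirectedGraph V Ed) : Prop :=
  ∀ (a : V) (l : List Ed), E.IsPath a l a → l = []

/-- A sink is a vertex that emits no edge. -/
def IsSink (E : DirectedGraph V Ed) (a : V) : Prop :=
  ∀ e : Ed, E.s e ≠ a

/-- The number of directed paths that end at `a` and whose length is congruent to `i` modulo `k`.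
A path is recorded by its initial vertex and its list of edges. -/
noncomputable def pathCount (E : DirectedGraph V Ed) (k : ℕ) (a : V) (i : ZMod k) : ℕ :=
  Nat.card {p : V × List Ed // E.IsPath p.1 p.2 a ∧ (p.2.length : ZMod k) = i}

/-! ### The graph C⋆-algebra -/

/-- A family of elements of a C⋆-algebra `B` satisfying the defining relations of `C⋆(E)`. -/
structure CuntzKriegerFamily (E : DirectedGraph V Ed) (B : Type w)
    [NonUnitalCStarAlgebra B] where
  /-- the vertex projections -/
  P : V → B
  /-- the edge partial isometries -/
  S : Ed → B
  isStarProjection_P : ∀ a, IsStarProjection (P a)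
  P_orthogonal : ∀ a b, a ≠ b → P a * P b = 0
  partialIsometry_S : ∀ e, S e * star (S e) * S e = S e
  ranges_orthogonal : ∀ e f, e ≠ f → (S e * star (S e)) * (S f * star (S f)) = 0
  star_S_mul_S : ∀ e, star (S e) * S e = P (E.r e)
  /-- `S e * star (S e) ≤ P (s e)`, written for projections `q ≤ p` as `p * q = q` -/
  range_le : ∀ e, P (E.s e) * (S e * star (S e)) = S e * star (S e)
  P_eq_sum : ∀ (a : V) (h : {e : Ed | E.s e = a}.Finite), {e : Ed | E.s e = a}.Nonempty →
    P a = ∑ e ∈ h.toFinset, S e * star (S e)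

namespace CuntzKriegerFamily

variable {E : DirectedGraph V Ed} {B : Type w} [NonUnitalCStarAlgebra B]

theorem norm_P_le (F : E.CuntzKriegerFamily B) (a : V) : ‖F.P a‖ ≤ 1 := by
  have h := F.isStarProjection_P a
  have h1 : ‖F.P a‖ * ‖F.P a‖ = ‖F.P a‖ := by
    have h2 := CStarRing.norm_star_mul_self (x := F.P a)
    rw [h.isSelfAdjoint.star_eq, h.isIdempotentElem.eq] at h2
    exact h2.symm
  nlinarith [norm_nonneg (F.P a)]

theorem norm_S_le (F : E.CuntzKriegerFamily B) (e : Ed) : ‖F.S e‖ ≤ 1 := by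
  have h2 := CStarRing.norm_star_mul_self (x := F.S e)
  rw [F.star_S_mul_S] at h2
  nlinarith [norm_nonneg (F.S e), F.norm_P_le (E.r e)]

/-- The family `(P, z • S)`, for `z` on the unit circle. -/
noncomputable def twist (F : E.CuntzKriegerFamily B) (z : Circle) : E.CuntzKriegerFamily B :=
  have hz : star (z : ℂ) * (z : ℂ) = 1 := by
    have h := Complex.conj_mul' (z : ℂ)
    rw [Circle.norm_coe] at h
    simpa using h
  have hz' : (z : ℂ) * star (z : ℂ) = 1 := by rw [mul_comm]; exact hz
  have h1 : ∀ e, ((z : ℂ) • F.S e) * star ((z : ℂ) • F.S e) = F.S e * star (F.S e) := by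
    intro e
    rw [star_smul, smul_mul_smul_comm, hz', one_smul]
  { P := F.P
    S := fun e => (z : ℂ) • F.S e
    isStarProjection_P := F.isStarProjection_P
    P_orthogonal := F.P_orthogonal
    partialIsometry_S := fun e => by
      rw [h1, mul_smul_comm, F.partialIsometry_S]
    ranges_orthogonal := fun e f h => by
      rw [h1, h1, F.ranges_orthogonal e f h]
    star_S_mul_S := fun e => by
      rw [star_smul, smul_mul_smul_comm, hz, one_smul, F.star_S_mul_S]
    range_le := fun e => by rw [h1, F.range_le]
    P_eq_sum := fun a h hne => by
      simp only [h1]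
      exact F.P_eq_sum a h hne }

end CuntzKriegerFamily

/-- A C⋆-algebra in the universe `w` together with a Cuntz–Krieger family in it. -/
structure Rep (E : DirectedGraph V Ed) : Type (max u v (w + 1)) where
  carrier : Type w
  [alg : NonUnitalCStarAlgebra carrier]
  family : E.CuntzKriegerFamily carrier

attribute [instance] Rep.alg

variable (E : DirectedGraph V Ed)

/-- The C⋆-algebra of all bounded elements of the product over all Cuntz–Krieger families. -/
abbrev RepProd : Type (max u v (w + 1)) :=
  lp (fun F : Rep.{u, v, w} E => F.carrier) ∞

/-- The vertex projection at `a` of all Cuntz–Krieger families at once. -/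
noncomputable def prodP (a : V) : RepProd.{u, v, w} E :=
  ⟨fun F => F.family.P a, memℓp_infty ⟨1, by rintro _ ⟨F, rfl⟩; exact F.family.norm_P_le a⟩⟩

/-- The partial isometry of the edge `e` of all Cuntz–Krieger families at once. -/
noncomputable def prodS (e : Ed) : RepProd.{u, v, w} E :=
  ⟨fun F => F.family.S e, memℓp_infty ⟨1, by rintro _ ⟨F, rfl⟩; exact F.family.norm_S_le e⟩⟩

/-- The closed ⋆-subalgebra generated by all `prodP a` and `prodS e`. -/
noncomputable def cstarSubalgebra : NonUnitalStarSubalgebra ℂ (RepProd.{u, v, w} E) :=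
  (NonUnitalStarAlgebra.adjoin ℂ
    (Set.range (prodP.{u, v, w} E) ∪ Set.range (prodS.{u, v, w} E))).topologicalClosure

/-- The graph C⋆-algebra `C⋆(E)`: the universal C⋆-algebra generated by a Cuntz–Krieger family,
realized inside the product of all Cuntz–Krieger families (see `CStar.lift` and `CStar.hom_ext`
for the universal property). -/
def CStar : Type (max u v (w + 1)) := cstarSubalgebra.{u, v, w} E

instance isClosed_cstarSubalgebra :
    IsClosed (cstarSubalgebra.{u, v, w} E : Set (RepProd.{u, v, w} E)) :=
  NonUnitalStarSubalgebra.isClosed_topologicalClosure _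

noncomputable instance : NonUnitalCStarAlgebra (CStar.{u, v, w} E) :=
  inferInstanceAs (NonUnitalCStarAlgebra (cstarSubalgebra.{u, v, w} E))

namespace CStar

/-- The vertex projection `P_a` of `C⋆(E)`. -/
noncomputable def vertexProj (a : V) : CStar.{u, v, w} E :=
  ⟨prodP E a, NonUnitalStarSubalgebra.le_topologicalClosure _
    (NonUnitalStarAlgebra.subset_adjoin ℂ _ (Or.inl ⟨a, rfl⟩))⟩

/-- The partial isometry `S_e` of `C⋆(E)`. -/
noncomputable def edgeIso (e : Ed) : CStar.{u, v, w} E :=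
  ⟨prodS E e, NonUnitalStarSubalgebra.le_topologicalClosure _
    (NonUnitalStarAlgebra.subset_adjoin ℂ _ (Or.inr ⟨e, rfl⟩))⟩

/-- The inclusion of `C⋆(E)` into the product. -/
noncomputable def incl : CStar.{u, v, w} E →⋆ₙₐ[ℂ] RepProd.{u, v, w} E :=
  NonUnitalStarSubalgebraClass.subtype (cstarSubalgebra.{u, v, w} E)

variable {E}

/-- Equality in `C⋆(E)` may be tested in every Cuntz–Krieger family. -/
theorem ext_rep {x y : CStar.{u, v, w} E} (h : ∀ F : Rep.{u, v, w} E, x.1 F = y.1 F) : x = y :=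
  Subtype.ext (lp.ext (funext h))

/-- A closed ⋆-subalgebra that contains the generators is everything. -/
theorem mem_of_generators (t : NonUnitalStarSubalgebra ℂ (CStar.{u, v, w} E))
    (ht : IsClosed (t : Set (CStar.{u, v, w} E))) (hP : ∀ a, vertexProj E a ∈ t)
    (hS : ∀ e, edgeIso E e ∈ t) (x : CStar.{u, v, w} E) : x ∈ t := by
  have hcl : IsClosed ((t.map (incl E) : NonUnitalStarSubalgebra ℂ (RepProd.{u, v, w} E)) :
      Set (RepProd.{u, v, w} E)) := by
    have h : IsClosedMap (incl.{u, v, w} E) :=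
      (isClosed_cstarSubalgebra.{u, v, w} E).isClosedEmbedding_subtypeVal.isClosedMap
    exact h _ ht
  have hle : cstarSubalgebra.{u, v, w} E ≤ t.map (incl E) := by
    refine NonUnitalStarSubalgebra.topologicalClosure_minimal _ ?_ hcl
    refine NonUnitalStarAlgebra.adjoin_le ?_
    rintro _ (⟨a, rfl⟩ | ⟨e, rfl⟩)
    · exact ⟨vertexProj E a, hP a, rfl⟩
    · exact ⟨edgeIso E e, hS e, rfl⟩
  obtain ⟨y, hy, hyx⟩ := hle x.2
  have : y = x := Subtype.ext hyx
  exact this ▸ hy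

/-- The generators of `C⋆(E)` form a Cuntz–Krieger family. -/
noncomputable def canonicalFamily : E.CuntzKriegerFamily (CStar.{u, v, w} E) where
  P := vertexProj E
  S := edgeIso E
  isStarProjection_P a :=
    ⟨ext_rep fun F => (F.family.isStarProjection_P a).isIdempotentElem.eq,
      ext_rep fun F => (F.family.isStarProjection_P a).isSelfAdjoint.star_eq⟩
  P_orthogonal a b h := ext_rep fun F => F.family.P_orthogonal a b h
  partialIsometry_S e := ext_rep fun F => F.family.partialIsometry_S e
  ranges_orthogonal e f h := ext_rep fun F => F.family.ranges_orthogonal e f h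
  star_S_mul_S e := ext_rep fun F => F.family.star_S_mul_S e
  range_le e := ext_rep fun F => F.family.range_le e
  P_eq_sum a h hne := by
    refine ext_rep fun F => (F.family.P_eq_sum a h hne).trans ?_
    have h2 : ∀ T : Finset Ed,
        (incl E (∑ e ∈ T, edgeIso E e * star (edgeIso E e)) : ∀ F : Rep.{u, v, w} E, F.carrier) F
          = ∑ e ∈ T, F.family.S e * star (F.family.S e) := by
      intro T
      rw [map_sum, lp.coeFn_sum, Finset.sum_apply]
      rfl
    exact (h2 _).symm

/-- The universal property, existence: every Cuntz–Krieger family is the image of the generators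
under a ⋆-homomorphism. -/
noncomputable def lift {B : Type w} [NonUnitalCStarAlgebra B] (F : E.CuntzKriegerFamily B) :
    CStar.{u, v, w} E →⋆ₙₐ[ℂ] B where
  toFun x := x.1 ⟨B, F⟩
  map_smul' _ _ := rfl
  map_zero' := rfl
  map_add' _ _ := rfl
  map_mul' _ _ := rfl
  map_star' _ := rfl

theorem lift_vertexProj {B : Type w} [NonUnitalCStarAlgebra B] (F : E.CuntzKriegerFamily B)
    (a : V) : lift F (vertexProj E a) = F.P a := rfl

theorem lift_edgeIso {B : Type w} [NonUnitalCStarAlgebra B] (F : E.CuntzKriegerFamily B)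
    (e : Ed) : lift F (edgeIso E e) = F.S e := rfl

theorem continuous_hom {A B : Type*} [NonUnitalCStarAlgebra A] [NonUnitalCStarAlgebra B]
    (φ : A →⋆ₙₐ[ℂ] B) : Continuous φ :=
  AddMonoidHomClass.continuous_of_bound φ 1 fun x => by
    simpa only [one_mul] using NonUnitalStarAlgHom.norm_apply_le φ x

/-- The universal property, uniqueness: a ⋆-homomorphism is determined on the generators. -/
theorem hom_ext {B : Type*} [NonUnitalCStarAlgebra B] {φ ψ : CStar.{u, v, w} E →⋆ₙₐ[ℂ] B}
    (hP : ∀ a, φ (vertexProj E a) = ψ (vertexProj E a))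
    (hS : ∀ e, φ (edgeIso E e) = ψ (edgeIso E e)) : φ = ψ := by
  have hφ : Continuous φ := continuous_hom φ
  have hψ : Continuous ψ := continuous_hom ψ
  refine DFunLike.ext _ _ fun x => ?_
  exact mem_of_generators (NonUnitalStarAlgHom.equalizer φ ψ) (isClosed_eq hφ hψ) hP hS x

/-! ### The unit -/

theorem vertexProj_mul_edgeIso (e : Ed) :
    vertexProj.{u, v, w} E (E.s e) * edgeIso E e = edgeIso E e := by
  have h1 : edgeIso E e * star (edgeIso E e) * edgeIso.{u, v, w} E e = edgeIso E e :=
    canonicalFamily.partialIsometry_S e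
  have h2 : vertexProj.{u, v, w} E (E.s e) * (edgeIso E e * star (edgeIso E e)) =
    edgeIso E e * star (edgeIso E e) := canonicalFamily.range_le e
  calc _ = vertexProj.{u, v, w} E (E.s e) * (edgeIso E e * star (edgeIso E e) * edgeIso E e) := by
        rw [h1]
    _ = _ := by rw [← mul_assoc, h2, h1]

theorem edgeIso_mul_vertexProj (e : Ed) :
    edgeIso.{u, v, w} E e * vertexProj E (E.r e) = edgeIso E e := by
  have h1 : edgeIso E e * star (edgeIso E e) * edgeIso.{u, v, w} E e = edgeIso E e :=
    canonicalFamily.partialIsometry_S e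
  have h2 : star (edgeIso.{u, v, w} E e) * edgeIso E e = vertexProj E (E.r e) :=
    canonicalFamily.star_S_mul_S e
  rw [← h2, ← mul_assoc, h1]

section unit

variable [Finite V]

/-- The sum of all vertex projections. -/
noncomputable def unit (E : DirectedGraph V Ed) : CStar.{u, v, w} E :=
  letI := Fintype.ofFinite V
  ∑ a, vertexProj E a

theorem unit_mul_vertexProj (b : V) : unit E * vertexProj.{u, v, w} E b = vertexProj E b := by
  classical
  let _ := Fintype.ofFinite V
  change (∑ a, vertexProj E a) * _ = _
  rw [Finset.sum_mul, Finset.sum_eq_single b]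
  · exact (canonicalFamily.isStarProjection_P b).isIdempotentElem.eq
  · intro a _ hab
    exact canonicalFamily.P_orthogonal a b hab
  · simp

theorem star_unit : star (unit.{u, v, w} E) = unit E := by
  let _ := Fintype.ofFinite V
  change star (∑ a, vertexProj E a) = ∑ a, vertexProj E a
  rw [star_sum]
  exact Finset.sum_congr rfl fun a _ =>
    (canonicalFamily.isStarProjection_P a).isSelfAdjoint.star_eq

theorem vertexProj_mul_unit (b : V) : vertexProj.{u, v, w} E b * unit E = vertexProj E b := by
  have h := congrArg star (unit_mul_vertexProj.{u, v, w} (E := E) b)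
  have h2 : star (vertexProj.{u, v, w} E b) = vertexProj E b :=
    (canonicalFamily.isStarProjection_P b).isSelfAdjoint.star_eq
  rwa [star_mul, star_unit, h2] at h

/-- The elements on which `unit E` acts as an identity on both sides. -/
noncomputable def unitSubalgebra (E : DirectedGraph V Ed) :
    NonUnitalStarSubalgebra ℂ (CStar.{u, v, w} E) where
  carrier := {x | unit E * x = x ∧ x * unit E = x}
  add_mem' := fun {x y} hx hy => by
    constructor
    · rw [mul_add, hx.1, hy.1]
    · rw [add_mul, hx.2, hy.2]
  zero_mem' := ⟨mul_zero _, zero_mul _⟩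
  mul_mem' := fun {x y} hx hy => by
    constructor
    · rw [← mul_assoc, hx.1]
    · rw [mul_assoc, hy.2]
  smul_mem' := fun c x hx => by
    constructor
    · rw [mul_smul_comm, hx.1]
    · rw [smul_mul_assoc, hx.2]
  star_mem' := fun {x} hx => by
    have h1 := congrArg star hx.1
    have h2 := congrArg star hx.2
    rw [star_mul, star_unit] at h1 h2
    exact ⟨h2, h1⟩

theorem unit_mul (x : CStar.{u, v, w} E) : unit E * x = x := by
  have key : x ∈ unitSubalgebra E := by
    refine mem_of_generators _ ?_ (fun a => ?_) (fun e => ?_) x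
    · exact (isClosed_eq (continuous_const.mul continuous_id) continuous_id).inter
        (isClosed_eq (continuous_id.mul continuous_const) continuous_id)
    · exact ⟨unit_mul_vertexProj a, vertexProj_mul_unit a⟩
    · constructor
      · rw [← vertexProj_mul_edgeIso, ← mul_assoc, unit_mul_vertexProj]
      · rw [← edgeIso_mul_vertexProj, mul_assoc, vertexProj_mul_unit]
  exact key.1

theorem mul_unit (x : CStar.{u, v, w} E) : x * unit E = x := by
  have h := congrArg star (unit_mul (star x))
  rwa [star_mul, star_star, star_unit] at h

end unit

/-- For a finite vertex set, `C⋆(E)` is unital; its unit is the sum of the vertex projections. -/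
noncomputable instance instNormedRing [Finite V] : NormedRing (CStar.{u, v, w} E) :=
  { (inferInstance : NonUnitalNormedRing (CStar.{u, v, w} E)) with
    one := unit E
    one_mul := unit_mul
    mul_one := mul_unit }

noncomputable instance instCStarAlgebra [Finite V] : CStarAlgebra (CStar.{u, v, w} E) :=
  { instNormedRing, (inferInstance : NonUnitalCStarAlgebra (CStar.{u, v, w} E)) with
    toAlgebra := Algebra.ofModule (fun c x y => smul_mul_assoc c x y)
      (fun c x y => mul_smul_comm c x y) }

/-! ### The gauge action -/

/-- The ⋆-endomorphism of the product that moves the coordinate of `(P, z • S)` to that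
of `(P, S)`. -/
noncomputable def prodGauge (E : DirectedGraph V Ed) (z : Circle) :
    RepProd.{u, v, w} E →⋆ₙₐ[ℂ] RepProd.{u, v, w} E where
  toFun x := ⟨fun F => x ⟨F.carrier, F.family.twist z⟩, memℓp_infty ⟨‖x‖, by
    rintro _ ⟨F, rfl⟩
    exact lp.norm_apply_le_norm ENNReal.top_ne_zero x ⟨F.carrier, F.family.twist z⟩⟩⟩
  map_smul' _ _ := rfl
  map_zero' := rfl
  map_add' _ _ := rfl
  map_mul' _ _ := rfl
  map_star' _ := rfl

theorem prodGauge_prodP (z : Circle) (a : V) :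
    prodGauge.{u, v, w} E z (prodP E a) = prodP E a := rfl

theorem prodGauge_prodS (z : Circle) (e : Ed) :
    prodGauge.{u, v, w} E z (prodS E e) = (z : ℂ) • prodS E e := rfl

theorem prodGauge_mem (z : Circle) (x : CStar.{u, v, w} E) :
    prodGauge E z x.1 ∈ cstarSubalgebra.{u, v, w} E := by
  have hc : Continuous (prodGauge.{u, v, w} E z) := continuous_hom _
  have hle : cstarSubalgebra.{u, v, w} E ≤
      (cstarSubalgebra.{u, v, w} E).comap (prodGauge E z) := by
    refine NonUnitalStarSubalgebra.topologicalClosure_minimal _ ?_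
      ((isClosed_cstarSubalgebra.{u, v, w} E).preimage hc)
    refine NonUnitalStarAlgebra.adjoin_le ?_
    rintro _ (⟨a, rfl⟩ | ⟨e, rfl⟩)
    · exact (vertexProj E a).2
    · exact (cstarSubalgebra.{u, v, w} E).smul_mem (z : ℂ) (edgeIso E e).2
  exact hle x.2

/-- The ⋆-endomorphism of `C⋆(E)` with `P_a ↦ P_a` and `S_e ↦ z • S_e`. -/
noncomputable def gaugeHom (E : DirectedGraph V Ed) (z : Circle) :
    CStar.{u, v, w} E →⋆ₙₐ[ℂ] CStar.{u, v, w} E where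
  toFun x := ⟨prodGauge E z x.1, prodGauge_mem z x⟩
  map_smul' _ _ := rfl
  map_zero' := rfl
  map_add' _ _ := rfl
  map_mul' _ _ := rfl
  map_star' _ := rfl

theorem gaugeHom_vertexProj (z : Circle) (a : V) :
    gaugeHom E z (vertexProj.{u, v, w} E a) = vertexProj E a := rfl

theorem gaugeHom_edgeIso (z : Circle) (e : Ed) :
    gaugeHom E z (edgeIso.{u, v, w} E e) = (z : ℂ) • edgeIso E e := rfl

theorem gaugeHom_one : gaugeHom.{u, v, w} E 1 = NonUnitalStarAlgHom.id ℂ _ :=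
  hom_ext (fun _ => rfl) fun e => by
    rw [gaugeHom_edgeIso]
    simp

theorem gaugeHom_mul (z z' : Circle) :
    gaugeHom.{u, v, w} E (z * z') = (gaugeHom E z).comp (gaugeHom E z') :=
  hom_ext (fun _ => rfl) fun e => by
    rw [NonUnitalStarAlgHom.comp_apply, gaugeHom_edgeIso, gaugeHom_edgeIso, map_smul,
      gaugeHom_edgeIso, smul_smul, mul_comm z z', Circle.coe_mul]

/-- The gauge action of the circle on `C⋆(E)`: the automorphism of `z` is given by
`P_a ↦ P_a` and `S_e ↦ z • S_e`. -/
noncomputable def gauge (E : DirectedGraph V Ed) :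
    Circle →* (CStar.{u, v, w} E ≃⋆ₐ[ℂ] CStar.{u, v, w} E) where
  toFun z :=
    { toFun := gaugeHom E z
      invFun := gaugeHom E z⁻¹
      left_inv := fun x => by
        rw [← NonUnitalStarAlgHom.comp_apply, ← gaugeHom_mul, inv_mul_cancel, gaugeHom_one]
        rfl
      right_inv := fun x => by
        rw [← NonUnitalStarAlgHom.comp_apply, ← gaugeHom_mul, mul_inv_cancel, gaugeHom_one]
        rfl
      map_mul' := map_mul _
      map_add' := map_add _
      map_smul' := map_smul _
      map_star' := map_star _ }
  map_one' := StarAlgEquiv.ext fun x => DFunLike.congr_fun gaugeHom_one x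
  map_mul' z z' := StarAlgEquiv.ext fun x => DFunLike.congr_fun (gaugeHom_mul z z') x

/-- The restriction of the gauge action to the cyclic subgroup `ℤ/k` of the circle: the class
of `m` acts as `exp (2πim/k)`. -/
noncomputable def cyclicGauge (E : DirectedGraph V Ed) (k : ℕ) [NeZero k] :
    Multiplicative (ZMod k) →* (CStar.{u, v, w} E ≃⋆ₐ[ℂ] CStar.{u, v, w} E) :=
  (gauge E).comp (ZMod.toCircle (N := k)).toMonoidHom

end CStar

end DirectedGraph

/-! ### Joins and the spaces `E_n G` -/

/-- The identifications of the topological join: the second coordinate is collapsed at `t = 0`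
and the first one at `t = 1`. -/
inductive TopJoin.Rel (X Y : Type*) : X × Y × unitInterval → X × Y × unitInterval → Prop
  | zero (x : X) (y y' : Y) : TopJoin.Rel X Y (x, y, 0) (x, y', 0)
  | one (x x' : X) (y : Y) : TopJoin.Rel X Y (x, y, 1) (x', y, 1)

/-- The topological join of two spaces, with the quotient topology of `X × Y × [0, 1]`. -/
def TopJoin (X Y : Type*) : Type _ := Quot (TopJoin.Rel X Y)

instance (X Y : Type*) [TopologicalSpace X] [TopologicalSpace Y] :
    TopologicalSpace (TopJoin X Y) :=
  inferInstanceAs (TopologicalSpace (Quot (TopJoin.Rel X Y)))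

/-- The map of joins `[x, y, t] ↦ [f x, g y, t]`. -/
def TopJoin.map {X Y : Type*} [TopologicalSpace X] [TopologicalSpace Y]
    (f : C(X, X)) (g : C(Y, Y)) : C(TopJoin X Y, TopJoin X Y) where
  toFun := Quot.map (fun p => (f p.1, g p.2.1, p.2.2)) (by
    rintro _ _ (⟨x, y, y'⟩ | ⟨x, x', y⟩)
    · exact TopJoin.Rel.zero _ _ _
    · exact TopJoin.Rel.one _ _ _)
  continuous_toFun := by
    refine continuous_quot_lift _ ?_
    exact continuous_quot_mk.comp (by fun_prop)

/-- The space `E_n G`: `E_0 G = G` and `E_{n+1} G = E_n G * G`. -/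
def EnSpace (G : Type u) [TopologicalSpace G] : ℕ → TopCat.{u}
  | 0 => TopCat.of G
  | n + 1 => TopCat.of (TopJoin (EnSpace G n) G)

/-- The diagonal action of `g` on `E_n G` by right translation in every coordinate. -/
def EnSpace.translate (G : Type u) [TopologicalSpace G] [Group G] [ContinuousMul G] (g : G) :
    ∀ n : ℕ, C(EnSpace G n, EnSpace G n)
  | 0 => (⟨fun h => h * g, continuous_mul_const g⟩ : C(G, G))
  | n + 1 => TopJoin.map (EnSpace.translate G g n) ⟨fun h => h * g, continuous_mul_const g⟩

/-! ### The local-triviality dimensions -/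

section Dimensions

variable (G : Type u) [TopologicalSpace G] [Group G] [IsTopologicalGroup G] [CompactSpace G]

/-- The translation action of `G` on `C₀((0, 1]) ⊗ C(G) = C₀((0, 1] × G)`, trivial on the first
factor: `(g • f) (s, h) = f (s, h * g)`. -/
noncomputable def coneTranslate (g : G) (f : C₀(Set.Ioc (0 : ℝ) 1 × G, ℂ)) :
    C₀(Set.Ioc (0 : ℝ) 1 × G, ℂ) :=
  f.comp (Homeomorph.toCocompactMap ((Homeomorph.refl _).prodCongr (Homeomorph.mulRight g)))

/-- The element `t ⊗ 1` of `C₀((0, 1]) ⊗ C(G) = C₀((0, 1] × G)`, where `t` is the identity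
function: `(s, h) ↦ s`. -/
noncomputable def coneHeight : C₀(Set.Ioc (0 : ℝ) 1 × G, ℂ) where
  toFun p := ((p.1 : ℝ) : ℂ)
  continuous_toFun := by fun_prop
  zero_at_infty' := by
    refine Metric.tendsto_nhds.mpr fun ε hε => Filter.mem_cocompact.mpr ?_
    have hK : IsCompact ((Subtype.val : Set.Ioc (0 : ℝ) 1 → ℝ) ⁻¹' Set.Icc ε 1) := by
      rw [Topology.IsInducing.subtypeVal.isCompact_iff, Subtype.image_preimage_coe]
      have h : Set.Ioc (0 : ℝ) 1 ∩ Set.Icc ε 1 = Set.Icc ε 1 :=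
        Set.inter_eq_right.mpr fun x hx => ⟨hε.trans_le hx.1, hx.2⟩
      rw [h]
      exact isCompact_Icc
    refine ⟨_, hK.prod (isCompact_univ (X := G)), fun p hp => ?_⟩
    have h0 : (0 : ℝ) < p.1 := p.1.2.1
    have h1 : ¬ ε ≤ (p.1 : ℝ) := fun h => hp ⟨⟨h, p.1.2.2⟩, Set.mem_univ _⟩
    change dist ((p.1 : ℝ) : ℂ) 0 < ε
    rw [dist_zero_right, Complex.norm_real, Real.norm_of_nonneg h0.le]
    exact not_le.mp h1

variable {A : Type v} [CStarAlgebra A]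

/-- There are `G`-equivariant ⋆-homomorphisms `ρ₀, …, ρₙ : C₀((0, 1]) ⊗ C(G) → A` with
`∑ ρᵢ (t ⊗ 1) = 1`. -/
def HasPlainLT (α : G →* (A ≃⋆ₐ[ℂ] A)) (n : ℕ) : Prop :=
  ∃ ρ : Fin (n + 1) → (C₀(Set.Ioc (0 : ℝ) 1 × G, ℂ) →⋆ₙₐ[ℂ] A),
    (∀ i g f, ρ i (coneTranslate G g f) = α g (ρ i f)) ∧ ∑ i, ρ i (coneHeight G) = 1

/-- There is a `G`-equivariant unital ⋆-homomorphism `C(E_n G) → A`. -/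
def HasStrongLT (α : G →* (A ≃⋆ₐ[ℂ] A)) (n : ℕ) : Prop :=
  ∃ Φ : C(EnSpace G n, ℂ) →⋆ₐ[ℂ] A,
    ∀ g f, Φ (f.comp (EnSpace.translate G g n)) = α g (Φ f)

/-- The plain local-triviality dimension of an action of `G` on `A`: the smallest `n` that works,
and `⊤` if there is none. -/
noncomputable def plainLTDim (α : G →* (A ≃⋆ₐ[ℂ] A)) : ℕ∞ :=
  ⨅ (n : ℕ) (_ : HasPlainLT G α n), (n : ℕ∞)

/-- The strong local-triviality dimension of an action of `G` on `A`: the smallest `n` that works,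
and `⊤` if there is none. -/
noncomputable def strongLTDim (α : G →* (A ≃⋆ₐ[ℂ] A)) : ℕ∞ :=
  ⨅ (n : ℕ) (_ : HasStrongLT G α n), (n : ℕ∞)

end Dimensions

/-! For a finite acyclic graph, `C⋆(E)` is a direct sum of full matrix algebras, one for each sink
`v`, with rows and columns indexed by the paths that end at `v`. On each block the gauge action of
`z` is conjugation by the diagonal matrix with entries `z ^ |l|`. The proof does not establish this
decomposition; it uses the block representations in one direction and the matrix units `S_x S_y⋆` in
the other.

Finite dimension implies equal counts. A plain or strong trivialization of any dimension gives
finitely many `b_i` with `∑ b_i² = 1` and `α_g(b_i) b_i = 0` for `g ≠ 1` (`HasFreePartition`). In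
the block of a sink, with `L` the diagonal matrix of a nontrivial element, this reads `b_i L b_i =
0`, so `tr L = ∑ tr(L b_i b_i) = ∑ tr(b_i L b_i) = 0` (`sum_pow_length_eq_zero`). These traces are
the nontrivial Fourier coefficients of the path count on `ℤ/k`; since they vanish, the count is
constant (`ZMod.eq_of_sum_mul_stdAddChar_eq_zero`).

Equal counts imply dimension zero. Bijections between the residue classes assemble into an action
`T` of `ℤ/k` on the paths to each sink that shifts length by `j` modulo `k` (`exists_shift`). Then
`U_j = ∑ S_{T_j x} S_x⋆` is a unitary representation of `ℤ/k` in `C⋆(E)` on which the gauge action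
acts by characters. Its spectral projections are permuted by the gauge action as the points of `ℤ/k`
are by translation, which yields an equivariant unital map from `C(ℤ/k)`
(`hasStrongLT_zero_of_dual`). Strong dimension `0` gives plain dimension `0` by evaluating the cone
at its end. -/

namespace DirectedGraph

/-! ### Paths in finite acyclic graphs -/

section Paths

variable {V : Type u} {Ed : Type v} {E : DirectedGraph V Ed}

theorem IsPath.append {a b c : V} {l l' : List Ed} (h : E.IsPath a l b) (h' : E.IsPath b l' c) :
    E.IsPath a (l ++ l') c := by
  induction l generalizing a with
  | nil => cases h; exact h'
  | cons e l ih => exact ⟨h.1, ih h.2⟩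

/-- The initial vertex of a path is determined by its list of edges and its final vertex. -/
theorem IsPath.start_unique {a a' b : V} {l : List Ed} (h : E.IsPath a l b)
    (h' : E.IsPath a' l b) : a = a' := by
  cases l with
  | nil => exact Eq.trans (b := b) h (Eq.symm h')
  | cons e l => exact h.1.symm.trans h'.1

/-- Reachability by a nonempty path is transitive, and acyclicity makes it irreflexive, which
suffices on a finite set. Induction along this relation starts at the sinks and moves against the
edges. -/
theorem IsAcyclic.wellFounded [Finite V] (hE : E.IsAcyclic) :
    WellFounded fun b a => ∃ e, E.s e = a ∧ E.r e = b := by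
  let R : V → V → Prop := fun b a => ∃ l, l ≠ [] ∧ E.IsPath a l b
  have h1 : IsTrans V R := ⟨fun c b a ⟨l, hl, h⟩ ⟨l', _, h'⟩ => ⟨l' ++ l, by simp [hl], h'.append h⟩⟩
  have h2 : Std.Irrefl R := ⟨fun a ⟨l, hl, h⟩ => hl (hE a l h)⟩
  have h3 : WellFounded R := Finite.wellFounded_of_trans_of_irrefl R
  refine Subrelation.wf ?_ h3
  rintro b a ⟨e, he, he'⟩
  exact ⟨[e], by simp, he, he'⟩

theorem IsAcyclic.finite_setOf_isPath [Finite V] [Finite Ed] (hE : E.IsAcyclic) (a : V) :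
    {p : List Ed × V | E.IsPath a p.1 p.2}.Finite := by
  induction a using hE.wellFounded.induction with
  | _ a ih =>
    have hfin : (⋃ e : {e : Ed // E.s e = a}, (fun p : List Ed × V => (e.1 :: p.1, p.2)) ''
        {p : List Ed × V | E.IsPath (E.r e.1) p.1 p.2}).Finite :=
      Set.finite_iUnion fun e => (ih _ ⟨e.1, e.2, rfl⟩).image _
    refine (hfin.insert ([], a)).subset ?_
    rintro ⟨l, b⟩ h
    cases l with
    | nil => left; cases h; rfl
    | cons e l => exact Or.inr (Set.mem_iUnion.mpr ⟨⟨e, h.1⟩, (l, b), h.2, rfl⟩)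

/-- The directed paths that end at `b`, recorded as in `pathCount`. -/
abbrev PathTo (E : DirectedGraph V Ed) (b : V) : Type (max u v) :=
  {p : V × List Ed // E.IsPath p.1 p.2 b}

theorem IsAcyclic.finite_pathTo [Finite V] [Finite Ed] (hE : E.IsAcyclic) (b : V) :
    Finite (E.PathTo b) := by
  have h : (⋃ a : V, (fun p : List Ed × V => (a, p.1)) ''
      {p : List Ed × V | E.IsPath a p.1 p.2}).Finite :=
    Set.finite_iUnion fun a => (hE.finite_setOf_isPath a).image _
  refine Set.Finite.to_subtype (h.subset ?_)
  rintro ⟨a, l⟩ hl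
  exact Set.mem_iUnion.mpr ⟨a, (l, b), hl, rfl⟩

theorem pathCount_eq_card (k : ℕ) (b : V) (i : ZMod k) :
    E.pathCount k b i = Nat.card {p : E.PathTo b // (p.1.2.length : ZMod k) = i} :=
  (Nat.card_congr (Equiv.subtypeSubtypeEquivSubtypeInter
    (fun p : V × List Ed => E.IsPath p.1 p.2 b) fun p => (p.2.length : ZMod k) = i)).symm

/-- The paths that end at a sink. -/
abbrev SinkPath (E : DirectedGraph V Ed) : Type (max u v) :=
  Σ b : {b : V // E.IsSink b}, E.PathTo b.1

end Paths

end DirectedGraph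

/-! ### Equal fibres and Fourier inversion -/

/-- If the fibres of a map to an additive group have the same size, then the group acts on its
domain compatibly with translation. -/
theorem exists_shift {X M : Type*} [AddGroup M] [Finite X] (len : X → M)
    (h : ∀ i j, Nat.card {x // len x = i} = Nat.card {x // len x = j}) :
    ∃ T : M → X → X, (∀ x, T 0 x = x) ∧ (∀ i j x, T i (T j x) = T (j + i) x) ∧
      ∀ j x, len (T j x) = len x + j := by
  -- Each fibre is matched once and for all with the fibre over `0`. Routing every shift through
  -- that fibre makes the shifts compose; arbitrary bijections between pairs of fibres would not.
  let e (i : M) : {x // len x = i} ≃ {x // len x = 0} := Classical.choice (Finite.card_eq.mp (h i 0))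
  have he : ∀ {i j : M} (hij : i = j) (x : X) (hx : len x = i) (hx' : len x = j),
      e i ⟨x, hx⟩ = e j ⟨x, hx'⟩ := by
    rintro i _ rfl x _ _; rfl
  have hs : ∀ {i j : M} (hij : i = j) y, ((e i).symm y).1 = ((e j).symm y).1 := by
    rintro i _ rfl y; rfl
  refine ⟨fun j x => (e (len x + j)).symm (e (len x) ⟨x, rfl⟩), fun x => ?_, fun i j x => ?_,
    fun j x => ((e (len x + j)).symm _).2⟩
  · dsimp only
    rw [hs (add_zero (len x)), Equiv.symm_apply_apply]
  · have hl := ((e (len x + j)).symm (e (len x) ⟨x, rfl⟩)).2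
    dsimp only
    rw [he hl _ rfl hl, Subtype.coe_eta, Equiv.apply_symm_apply]
    exact hs (by rw [hl, add_assoc]) _

/-- A function on `ℤ/k` whose nontrivial Fourier coefficients vanish is constant. -/
theorem ZMod.eq_of_sum_mul_stdAddChar_eq_zero {k : ℕ} [NeZero k] (c : ZMod k → ℂ)
    (h : ∀ g : ZMod k, g ≠ 0 → ∑ i, c i * ZMod.stdAddChar (g * i) = 0) (i j : ZMod k) :
    c i = c j := by
  have key : ∀ j : ZMod k, (k : ℂ) * c j = ∑ i, c i := by
    intro j
    -- The double sum is evaluated in both orders: summing over `g` first isolates `c j`, while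
    -- summing over `i` first leaves only the term `g = 0`, which does not depend on `j`.
    have h1 : ∑ g : ZMod k, ∑ i, c i * ZMod.stdAddChar (g * (i - j)) = (k : ℂ) * c j := by
      rw [Finset.sum_comm]
      simp_rw [← Finset.mul_sum, AddChar.sum_mulShift _ (ZMod.isPrimitive_stdAddChar k),
        sub_eq_zero]
      simp [mul_comm]
    rw [← h1, Finset.sum_eq_single 0]
    · simp
    · intro g _ hg
      have h2 : ∀ i, c i * ZMod.stdAddChar (g * (i - j)) =
          c i * ZMod.stdAddChar (g * i) * ZMod.stdAddChar (-(g * j)) := by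
        intro i
        rw [mul_assoc, ← AddChar.map_add_eq_mul, mul_sub, sub_eq_add_neg]
      simp_rw [h2, ← Finset.sum_mul, h g hg, zero_mul]
    · simp
  exact mul_left_cancel₀ (Nat.cast_ne_zero.mpr (NeZero.ne k)) ((key i).trans (key j).symm)

/-! ### Partitions of unity by functions with disjoint translates -/

section Partition

variable {G : Type u}

/-- There are finitely many elements whose squares sum to `1` and each of which is annihilated by
its nontrivial translates. -/
def HasFreePartition [One G] {A : Type*} [Semiring A] (α : G → A → A) : Prop :=
  ∃ (ι : Type u) (_ : Fintype ι) (b : ι → A),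
    ∑ i, b i * b i = 1 ∧ ∀ i g, g ≠ 1 → α g (b i) * b i = 0

theorem HasFreePartition.map [One G] {A B F : Type*} [Semiring A] [Semiring B] [FunLike F A B]
    [RingHomClass F A B] {α : G → A → A} {β : G → B → B} (h : HasFreePartition α) (φ : F)
    (hφ : ∀ g a, φ (α g a) = β g (φ a)) : HasFreePartition β := by
  obtain ⟨ι, _, b, h1, h2⟩ := h
  refine ⟨ι, inferInstance, fun i => φ (b i), ?_, fun i g hg => ?_⟩
  · simp_rw [← map_mul, ← map_sum, h1, map_one]
  · rw [← hφ, ← map_mul, h2 i g hg, map_zero]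

/-- The function `[x, y, t] ↦ f x * √(1 - t)` on the join. -/
noncomputable def TopJoin.extendLeft {X Y : Type*} [TopologicalSpace X] [TopologicalSpace Y]
    (f : C(X, ℂ)) : C(TopJoin X Y, ℂ) where
  -- The weight vanishes at `t = 1`, where the first coordinate is collapsed. Square roots are taken
  -- because partitions are normalized by the sum of squares.
  toFun := Quot.lift (fun p => f p.1 * (√(1 - (p.2.2 : ℝ)) : ℝ)) (by
    rintro _ _ (⟨x, y, y'⟩ | ⟨x, x', y⟩) <;> simp)
  continuous_toFun := by
    refine continuous_quot_lift _ ?_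
    fun_prop

/-- The function `[x, y, t] ↦ f y * √t` on the join. -/
noncomputable def TopJoin.extendRight {X Y : Type*} [TopologicalSpace X] [TopologicalSpace Y]
    (f : C(Y, ℂ)) : C(TopJoin X Y, ℂ) where
  toFun := Quot.lift (fun p => f p.2.1 * (√(p.2.2 : ℝ) : ℝ)) (by
    rintro _ _ (⟨x, y, y'⟩ | ⟨x, x', y⟩) <;> simp)
  continuous_toFun := by
    refine continuous_quot_lift _ ?_
    fun_prop

/-- The indicator function of a point of a discrete space. -/
noncomputable def discreteIndicator {X : Type*} [TopologicalSpace X] [DiscreteTopology X] (h : X) :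
    C(X, ℂ) where
  toFun := ({h} : Set X).indicator 1
  continuous_toFun := continuous_of_discreteTopology

theorem sum_indicator_mul_indicator {G : Type*} [Fintype G] (x : G) :
    ∑ h : G, ({h} : Set G).indicator (1 : G → ℂ) x * ({h} : Set G).indicator (1 : G → ℂ) x = 1 := by
  rw [Finset.sum_eq_single x]
  · simp
  · intro b _ hb
    simp [hb.symm]
  · simp

theorem indicator_translate_mul_indicator {G : Type*} [Group G] (h x : G) {g : G} (hg : g ≠ 1) :
    ({h} : Set G).indicator (1 : G → ℂ) (x * g) * ({h} : Set G).indicator (1 : G → ℂ) x = 0 := by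
  by_cases hx : x = h
  · subst hx
    simp [hg]
  · simp [hx]

variable [TopologicalSpace G] [Group G] [DiscreteTopology G] [IsTopologicalGroup G]

/-- On `G` the indicators of points work. A join inherits the partitions of its two factors,
weighted by `√(1 - t)` and `√t`: the squares of the weights add up to `1`, and `t` is invariant, so
disjointness of translates survives. -/
theorem hasFreePartition_enSpace [Finite G] (n : ℕ) :
    HasFreePartition fun (g : G) (f : C(EnSpace G n, ℂ)) => f.comp (EnSpace.translate G g n) := by
  have := Fintype.ofFinite G
  induction n with
  | zero =>
    refine ⟨G, inferInstance, fun h => discreteIndicator (X := G) h, ?_, fun h g hg => ?_⟩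
    · refine ContinuousMap.ext fun x => ?_
      rw [ContinuousMap.sum_apply]
      exact sum_indicator_mul_indicator (G := G) x
    · exact ContinuousMap.ext fun x => indicator_translate_mul_indicator (G := G) h x hg
  | succ n ih =>
    obtain ⟨ι, _, b, h1, h2⟩ := ih
    refine ⟨ι ⊕ G, inferInstance,
      Sum.elim (fun i => TopJoin.extendLeft (X := EnSpace G n) (Y := G) (b i))
        (fun h => TopJoin.extendRight (X := EnSpace G n) (Y := G) (discreteIndicator h)), ?_, ?_⟩
    · refine ContinuousMap.ext fun x => ?_
      rw [ContinuousMap.sum_apply, Fintype.sum_sum_type]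
      induction x using Quot.ind with
      | _ p =>
      obtain ⟨x, y, t⟩ := p
      have hb : ∑ i, b i x * b i x = 1 := by
        have := congrArg (fun f : C(EnSpace G n, ℂ) => f x) h1
        simpa [ContinuousMap.sum_apply] using this
      have e1 : ∀ i, b i x * (√(1 - (t : ℝ)) : ℝ) * (b i x * (√(1 - (t : ℝ)) : ℝ)) =
          b i x * b i x * (1 - (t : ℝ) : ℝ) := by
        intro i
        rw [mul_mul_mul_comm, ← Complex.ofReal_mul, Real.mul_self_sqrt (by linarith [t.2.2])]
      have e2 : ∀ c : ℂ, c * (√(t : ℝ) : ℝ) * (c * (√(t : ℝ) : ℝ)) = c * c * (t : ℝ) := by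
        intro c
        rw [mul_mul_mul_comm, ← Complex.ofReal_mul, Real.mul_self_sqrt t.2.1]
      change ∑ i, b i x * (√(1 - (t : ℝ)) : ℝ) * (b i x * (√(1 - (t : ℝ)) : ℝ)) +
        ∑ h, ({h} : Set G).indicator (1 : G → ℂ) y * (√(t : ℝ) : ℝ) *
          (({h} : Set G).indicator (1 : G → ℂ) y * (√(t : ℝ) : ℝ)) = 1
      simp_rw [e1, e2, ← Finset.sum_mul, hb, sum_indicator_mul_indicator]
      push_cast
      ring
    · rintro (i | h) g hg <;> refine ContinuousMap.ext fun x => ?_ <;>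
        induction x using Quot.ind with
        | _ p =>
        obtain ⟨x, y, t⟩ := p
        first
        | change b i (EnSpace.translate G g n x) * (√(1 - (t : ℝ)) : ℝ) *
            (b i x * (√(1 - (t : ℝ)) : ℝ)) = 0
          have hb : b i (EnSpace.translate G g n x) * b i x = 0 :=
            congrArg (fun f : C(EnSpace G n, ℂ) => f x) (h2 i g hg)
          rw [mul_mul_mul_comm, hb, zero_mul]
        | change ({h} : Set G).indicator (1 : G → ℂ) (y * g) * (√(t : ℝ) : ℝ) *
            (({h} : Set G).indicator (1 : G → ℂ) y * (√(t : ℝ) : ℝ)) = 0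
          rw [mul_mul_mul_comm, indicator_translate_mul_indicator h y hg, zero_mul]

variable [CompactSpace G]

/-- The function `(s, x) ↦ √s` at `x = h`, and `0` elsewhere, on the cone over a discrete group. -/
noncomputable def coneIndicator (h : G) : C₀(Set.Ioc (0 : ℝ) 1 × G, ℂ) where
  toFun p := (√(p.1 : ℝ) : ℝ) * discreteIndicator h p.2
  continuous_toFun := by fun_prop
  zero_at_infty' := by
    -- The function is dominated by the square root of the height, so its decay follows from that of
    -- `coneHeight G`.
    have h0 : Filter.Tendsto (fun p => √‖coneHeight G p‖) (Filter.cocompact _) (𝓝 0) := by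
      have := (coneHeight G).zero_at_infty'.norm.sqrt
      simpa using this
    refine squeeze_zero_norm (fun p => ?_) h0
    have hp : ‖coneHeight G p‖ = p.1 := by
      change ‖((p.1 : ℝ) : ℂ)‖ = _
      rw [Complex.norm_real, Real.norm_of_nonneg p.1.2.1.le]
    rw [hp, norm_mul, Complex.norm_real, Real.norm_of_nonneg (Real.sqrt_nonneg _)]
    refine mul_le_of_le_one_right (Real.sqrt_nonneg _) ?_
    refine (norm_indicator_le_norm_self _ _).trans ?_
    simp

/-- The elements `√t ⊗ δ_h` of the cone have squares summing to `t ⊗ 1` and orthogonal translates.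
Their images under all the `ρ i` therefore have squares summing to `1`. -/
theorem HasPlainLT.hasFreePartition {A : Type v} [CStarAlgebra A] {α : G →* (A ≃⋆ₐ[ℂ] A)}
    {n : ℕ} (h : HasPlainLT G α n) : HasFreePartition fun g => α g := by
  have : Finite G := finite_of_compact_of_discrete
  have := Fintype.ofFinite G
  obtain ⟨ρ, h1, h2⟩ := h
  -- `ULift` places the index type in the universe of `G`, as `HasFreePartition` demands.
  refine ⟨ULift (Fin (n + 1)) × G, inferInstance, fun i => ρ i.1.down (coneIndicator i.2), ?_,
    fun i g hg => ?_⟩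
  · have h3 : ∑ h, coneIndicator h * coneIndicator h = coneHeight G := by
      refine ZeroAtInftyContinuousMap.ext fun p => ?_
      let ev : C₀(Set.Ioc (0 : ℝ) 1 × G, ℂ) →+ ℂ :=
        { toFun := fun f => f p, map_zero' := rfl, map_add' := fun _ _ => rfl }
      change ev _ = _
      rw [map_sum]
      change ∑ h, (√(p.1 : ℝ) : ℝ) * ({h} : Set G).indicator (1 : G → ℂ) p.2 *
        ((√(p.1 : ℝ) : ℝ) * ({h} : Set G).indicator (1 : G → ℂ) p.2) = ((p.1 : ℝ) : ℂ)
      simp_rw [mul_mul_mul_comm, ← Complex.ofReal_mul, Real.mul_self_sqrt p.1.2.1.le,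
        ← Finset.mul_sum, sum_indicator_mul_indicator, mul_one]
    rw [Fintype.sum_prod_type]
    simp_rw [← map_mul, ← map_sum, h3]
    rw [← h2]
    exact Fintype.sum_equiv Equiv.ulift _ _ fun _ => rfl
  · have h3 : coneTranslate G g (coneIndicator i.2) * coneIndicator i.2 = 0 := by
      refine ZeroAtInftyContinuousMap.ext fun p => ?_
      change (√(p.1 : ℝ) : ℝ) * ({i.2} : Set G).indicator (1 : G → ℂ) (p.2 * g) *
        ((√(p.1 : ℝ) : ℝ) * ({i.2} : Set G).indicator (1 : G → ℂ) p.2) = 0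
      rw [mul_mul_mul_comm, indicator_translate_mul_indicator _ _ hg, mul_zero]
    dsimp only
    rw [← h1, ← map_mul, h3, map_zero]

theorem HasStrongLT.hasFreePartition {A : Type v} [CStarAlgebra A] {α : G →* (A ≃⋆ₐ[ℂ] A)}
    {n : ℕ} (h : HasStrongLT G α n) : HasFreePartition fun g => α g := by
  have : Finite G := finite_of_compact_of_discrete
  obtain ⟨Φ, hΦ⟩ := h
  exact (hasFreePartition_enSpace n).map Φ hΦ

/-- A strong local trivialization of dimension `0` gives a plain one, by evaluation at `t = 1`. -/
theorem HasStrongLT.hasPlainLT_zero {G : Type u} [TopologicalSpace G] [Group G]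
    [IsTopologicalGroup G] [CompactSpace G] {A : Type v} [CStarAlgebra A] {α : G →* (A ≃⋆ₐ[ℂ] A)}
    (h : HasStrongLT G α 0) : HasPlainLT G α 0 := by
  obtain ⟨Φ, hΦ⟩ := h
  let ev : C₀(Set.Ioc (0 : ℝ) 1 × G, ℂ) →⋆ₙₐ[ℂ] C(EnSpace G 0, ℂ) :=
    { toFun := fun f => (⟨fun x => f (⟨1, by simp⟩, x), by fun_prop⟩ : C(G, ℂ))
      map_smul' := fun _ _ => rfl
      map_zero' := rfl
      map_add' := fun _ _ => rfl
      map_mul' := fun _ _ => rfl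
      map_star' := fun _ => rfl }
  refine ⟨fun _ => (Φ : C(EnSpace G 0, ℂ) →⋆ₙₐ[ℂ] A).comp ev, fun _ g f => ?_, ?_⟩
  · exact hΦ g (ev f)
  · have h1 : ev (coneHeight G) = 1 := ContinuousMap.ext fun x => Complex.ofReal_one
    rw [Fin.sum_univ_one]
    change Φ (ev (coneHeight G)) = 1
    rw [h1, map_one]

end Partition

namespace DirectedGraph

/-! ### The representation on the paths that end at a sink -/

section PathRepresentation

open scoped ComplexOrder

open scoped Classical in
/-- The diagonal matrix with entries `0` and `1` given by a predicate. -/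
noncomputable def diagMatrix {ι : Type w} (Q : ι → Prop) : CStarMatrix ι ι ℂ :=
  fun i j => if i = j ∧ Q i then 1 else 0

section diagMatrix

variable {ι : Type w}

theorem star_diagMatrix (Q : ι → Prop) : star (diagMatrix Q) = diagMatrix Q := by
  ext i j
  rw [CStarMatrix.star_apply]
  unfold diagMatrix
  by_cases h : i = j
  · subst h
    by_cases hQ : Q i <;> simp [hQ]
  · simp [h, Ne.symm h]

variable [Fintype ι]

theorem diagMatrix_mul_apply (Q : ι → Prop) [DecidablePred Q] (M : CStarMatrix ι ι ℂ) (i j : ι) :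
    (diagMatrix Q * M) i j = if Q i then M i j else 0 := by
  rw [CStarMatrix.mul_apply, Finset.sum_eq_single i]
  · by_cases h : Q i <;> simp [diagMatrix, h]
  · intro l _ hl
    simp [diagMatrix, hl.symm]
  · simp

theorem diagMatrix_mul_diagMatrix (Q Q' : ι → Prop) :
    diagMatrix Q * diagMatrix Q' = diagMatrix fun i => Q i ∧ Q' i := by
  classical
  ext i j
  rw [diagMatrix_mul_apply]
  by_cases h : Q i <;> simp [diagMatrix, h]

end diagMatrix

variable {V : Type u} {Ed : Type v} {E : DirectedGraph V Ed} {b : V}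
  {ι : Type w} [Fintype ι] (p : ι ≃ E.PathTo b)

open scoped Classical in
/-- The matrix of the map `l ↦ e :: l` on paths that end at `b`. -/
noncomputable def consMatrix (e : Ed) : CStarMatrix ι ι ℂ :=
  fun i j => if (p i).1.2 = e :: (p j).1.2 then 1 else 0

theorem pathTo_ext {x y : E.PathTo b} (h : x.1.2 = y.1.2) : x = y := by
  obtain ⟨⟨a, l⟩, hx⟩ := x
  obtain ⟨⟨a', l'⟩, hy⟩ := y
  cases h
  cases IsPath.start_unique hx hy
  rfl

/-- Prepending `e` is injective and is possible exactly for the paths that start at the range of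
`e`, so a diagonal entry has at most one nonzero summand and an off-diagonal entry has none. -/
theorem star_consMatrix_mul_consMatrix (e : Ed) :
    star (consMatrix p e) * consMatrix p e = diagMatrix fun i => (p i).1.1 = E.r e := by
  ext i j
  rw [CStarMatrix.mul_apply]
  simp_rw [CStarMatrix.star_apply]
  unfold consMatrix diagMatrix
  by_cases h : i = j ∧ (p i).1.1 = E.r e
  · obtain ⟨rfl, h⟩ := h
    have hp : E.IsPath (E.s e) (e :: (p i).1.2) b := ⟨rfl, h ▸ (p i).2⟩
    rw [Finset.sum_eq_single (p.symm ⟨(E.s e, e :: (p i).1.2), hp⟩)]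
    · simp [h]
    · intro m _ hm
      rw [if_neg]
      · simp
      · intro hm'
        exact hm ((Equiv.eq_symm_apply p).mpr (pathTo_ext hm'))
    · simp
  · rw [if_neg h]
    refine Finset.sum_eq_zero fun m _ => ?_
    by_cases h1 : (p m).1.2 = e :: (p i).1.2
    · by_cases h2 : (p m).1.2 = e :: (p j).1.2
      · refine absurd ⟨p.injective (pathTo_ext (List.cons.inj (h1.symm.trans h2)).2), ?_⟩ h
        have h3 := (p m).2
        rw [h1] at h3
        exact IsPath.start_unique (p i).2 h3.2
      · simp [h2]
    · simp [h1]

theorem consMatrix_mul_star_consMatrix (e : Ed) :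
    consMatrix p e * star (consMatrix p e) = diagMatrix fun i => (p i).1.2.head? = some e := by
  ext i j
  rw [CStarMatrix.mul_apply]
  simp_rw [CStarMatrix.star_apply]
  unfold consMatrix diagMatrix
  by_cases h : i = j ∧ (p i).1.2.head? = some e
  · obtain ⟨rfl, h⟩ := h
    obtain ⟨l, hl⟩ : ∃ l, (p i).1.2 = e :: l := by
      cases h' : (p i).1.2 with
      | nil => simp [h'] at h
      | cons e' l =>
        rw [h'] at h
        exact ⟨l, by rw [Option.some.inj h]⟩
    have hp : E.IsPath (E.r e) l b := by
      have h3 := (p i).2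
      rw [hl] at h3
      exact h3.2
    rw [Finset.sum_eq_single (p.symm ⟨(E.r e, l), hp⟩)]
    · simp [hl]
    · intro m _ hm
      rw [if_neg]
      · simp
      · intro hm'
        rw [hl] at hm'
        exact hm ((Equiv.eq_symm_apply p).mpr (pathTo_ext (List.cons.inj hm').2.symm))
    · simp
  · rw [if_neg h]
    refine Finset.sum_eq_zero fun m _ => ?_
    by_cases h1 : (p i).1.2 = e :: (p m).1.2
    · by_cases h2 : (p j).1.2 = e :: (p m).1.2
      · exact absurd ⟨p.injective (pathTo_ext (h1.trans h2.symm)), by simp [h1]⟩ h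
      · simp [h2]
    · simp [h1]

theorem start_eq_of_head? {x : E.PathTo b} {e : Ed} (h : x.1.2.head? = some e) :
    x.1.1 = E.s e := by
  obtain ⟨⟨a, l⟩, hx⟩ := x
  cases l with
  | nil => simp at h
  | cons e' l =>
    cases Option.some.inj h
    exact hx.1.symm

theorem consMatrix_mul_diagMatrix (e : Ed) :
    consMatrix p e * diagMatrix (fun i => (p i).1.1 = E.r e) = consMatrix p e := by
  classical
  ext i j
  rw [CStarMatrix.mul_apply, Finset.sum_eq_single j]
  · unfold consMatrix diagMatrix
    by_cases h : (p i).1.2 = e :: (p j).1.2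
    · have h3 := (p i).2
      rw [h] at h3
      simp [h, IsPath.start_unique (p j).2 h3.2]
    · simp [h]
  · intro m _ hm
    simp [diagMatrix, hm]
  · simp

/-- The Cuntz–Krieger family of matrices on the paths that end at a sink. -/
noncomputable def pathFamily (hb : E.IsSink b) :
    E.CuntzKriegerFamily (CStarMatrix ι ι ℂ) where
  P a := diagMatrix fun i => (p i).1.1 = a
  S := consMatrix p
  isStarProjection_P a := by
    refine ⟨?_, star_diagMatrix _⟩
    rw [IsIdempotentElem, diagMatrix_mul_diagMatrix]
    simp
  P_orthogonal a c h := by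
    rw [diagMatrix_mul_diagMatrix]
    ext i j
    exact if_neg fun hh => h (hh.2.1.symm.trans hh.2.2)
  partialIsometry_S e := by
    rw [mul_assoc, star_consMatrix_mul_consMatrix, consMatrix_mul_diagMatrix]
  ranges_orthogonal e f h := by
    rw [consMatrix_mul_star_consMatrix, consMatrix_mul_star_consMatrix, diagMatrix_mul_diagMatrix]
    ext i j
    exact if_neg fun hh => h (Option.some.inj (hh.2.1.symm.trans hh.2.2))
  star_S_mul_S := star_consMatrix_mul_consMatrix p
  range_le e := by
    rw [consMatrix_mul_star_consMatrix, diagMatrix_mul_diagMatrix]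
    congr 1
    funext i
    exact propext (and_iff_right_of_imp start_eq_of_head?)
  P_eq_sum a h hne := by
    classical
    simp_rw [consMatrix_mul_star_consMatrix]
    ext i j
    have hsum : ∀ T : Finset Ed, (∑ e ∈ T, diagMatrix fun i => (p i).1.2.head? = some e) i j =
        ∑ e ∈ T, (diagMatrix fun i => (p i).1.2.head? = some e) i j := fun T => by
      induction T using Finset.induction_on with
      | empty => rfl
      | insert e T he ih =>
        rw [Finset.sum_insert he, Finset.sum_insert he, CStarMatrix.add_apply, ih]
    rw [hsum]
    unfold diagMatrix
    by_cases hij : i = j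
    · subst hij
      cases hl : (p i).1.2 with
      | nil =>
        obtain ⟨e, he⟩ := hne
        have h3 := (p i).2
        rw [hl] at h3
        -- This is where the sink hypothesis enters: the empty path lies in no range `S_e S_e⋆`, so
        -- its initial vertex `b` must emit no edge.
        have : (p i).1.1 ≠ a := fun h4 => hb e (he.trans (h4.symm.trans h3))
        simp [this, hl]
      | cons e l =>
        have h4 : (p i).1.1 = E.s e := start_eq_of_head? (by rw [hl]; rfl)
        by_cases ha : E.s e = a
        · rw [Finset.sum_eq_single e]
          · simp [h4, ha, hl]
          · intro f _ hf
            simp [hf.symm, hl]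
          · simp [ha]
        · rw [if_neg fun hh => ha (h4.symm.trans hh.2), Finset.sum_eq_zero]
          intro f hf
          rw [Set.Finite.mem_toFinset] at hf
          refine if_neg fun hh => ha ?_
          have hh' : (p i).1.2.head? = some f := hh.2
          rw [hl] at hh'
          rw [Option.some.inj hh']
          exact hf
    · simp [hij]

/-- `CStar.lift` is a non-unital homomorphism, so this needs proof: the unit is the sum of the
vertex projections, and every path has exactly one initial vertex. -/
theorem lift_pathFamily_one [Finite V] (hb : E.IsSink b) [DecidableEq ι] :
    CStar.lift (pathFamily p hb) (1 : CStar.{u, v, w} E) = 1 := by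
  have := Fintype.ofFinite V
  have h1 : CStar.lift (pathFamily p hb) (1 : CStar.{u, v, w} E) =
      ∑ a, diagMatrix fun i => (p i).1.1 = a := by
    change CStar.lift (pathFamily p hb) (CStar.unit E) = _
    rw [CStar.unit, map_sum]
    exact Finset.sum_congr (by ext; simp) fun a _ => rfl
  rw [h1]
  ext i j
  have hsum : ∀ T : Finset V, (∑ a ∈ T, diagMatrix fun i => (p i).1.1 = a) i j =
      ∑ a ∈ T, (diagMatrix fun i => (p i).1.1 = a) i j := fun T => by
    classical
    induction T using Finset.induction_on with
    | empty => rfl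
    | insert e T he ih =>
      rw [Finset.sum_insert he, Finset.sum_insert he, CStarMatrix.add_apply, ih]
  rw [hsum, Finset.sum_eq_single (p i).1.1]
  · simp [diagMatrix, CStarMatrix.one_apply]
  · intro a _ ha
    exact if_neg fun hh => ha hh.2.symm
  · simp

variable [DecidableEq ι]

/-- The diagonal matrix with entries `z ^ |l|`, for `l` a path that ends at `b`. -/
noncomputable def lengthMatrix (z : Circle) : CStarMatrix ι ι ℂ :=
  CStarMatrix.ofMatrix (Matrix.diagonal fun i => (z : ℂ) ^ (p i).1.2.length)

theorem lengthMatrix_mul_apply (z : Circle) (M : CStarMatrix ι ι ℂ) (i j : ι) :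
    (lengthMatrix p z * M) i j = (z : ℂ) ^ (p i).1.2.length * M i j :=
  Matrix.diagonal_mul _ M i j

theorem mul_lengthMatrix_apply (z : Circle) (M : CStarMatrix ι ι ℂ) (i j : ι) :
    (M * lengthMatrix p z) i j = M i j * (z : ℂ) ^ (p j).1.2.length :=
  Matrix.mul_diagonal _ M i j

theorem lengthMatrix_mul (z z' : Circle) :
    lengthMatrix p z * lengthMatrix p z' = lengthMatrix p (z * z') := by
  ext i j
  rw [lengthMatrix_mul_apply]
  by_cases h : i = j
  · subst h
    simp [lengthMatrix, mul_pow]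
  · simp [lengthMatrix, h]

theorem lengthMatrix_one {ι : Type w} [DecidableEq ι] (p : ι ≃ E.PathTo b) :
    lengthMatrix p 1 = 1 := by
  ext i j
  simp [lengthMatrix, Matrix.one_apply, CStarMatrix.one_apply]

theorem star_lengthMatrix {ι : Type w} [DecidableEq ι] (p : ι ≃ E.PathTo b) (z : Circle) :
    star (lengthMatrix p z) = lengthMatrix p z⁻¹ := by
  ext i j
  rw [CStarMatrix.star_apply]
  by_cases h : i = j
  · subst h
    simp only [lengthMatrix, CStarMatrix.ofMatrix_apply, Matrix.diagonal_apply_eq, star_pow,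
      Circle.coe_inv_eq_conj]
    rfl
  · simp [lengthMatrix, h, Ne.symm h]

/-- Conjugation by `lengthMatrix p z`. -/
noncomputable def conjLengthMatrix (z : Circle) : CStarMatrix ι ι ℂ →⋆ₙₐ[ℂ] CStarMatrix ι ι ℂ where
  toFun M := lengthMatrix p z * M * lengthMatrix p z⁻¹
  map_smul' c M := by
    rw [mul_smul_comm, smul_mul_assoc]
    rfl
  map_zero' := by rw [mul_zero, zero_mul]
  map_add' M N := by rw [mul_add, add_mul]
  map_mul' M N := by
    have h : lengthMatrix p z⁻¹ * lengthMatrix p z = 1 := by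
      rw [lengthMatrix_mul, inv_mul_cancel, lengthMatrix_one]
    calc _ = lengthMatrix p z * M * 1 * N * lengthMatrix p z⁻¹ := by
          rw [mul_one]
          simp only [mul_assoc]
      _ = _ := by
          rw [← h]
          simp only [mul_assoc]
  map_star' M := by
    rw [star_mul, star_mul, star_lengthMatrix, star_lengthMatrix, inv_inv, mul_assoc]

/-- In the path representation, the gauge action is implemented by the length matrices. -/
theorem lift_pathFamily_gauge (hb : E.IsSink b) (z : Circle) (x : CStar.{u, v, w} E) :
    CStar.lift (pathFamily p hb) (CStar.gauge E z x) =
      lengthMatrix p z * CStar.lift (pathFamily p hb) x * lengthMatrix p z⁻¹ := by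
  have h : (CStar.lift (pathFamily p hb)).comp (CStar.gaugeHom.{u, v, w} E z) =
      (conjLengthMatrix p z).comp (CStar.lift (pathFamily p hb)) := by
    refine CStar.hom_ext (fun a => ?_) fun e => ?_
    · change diagMatrix _ = lengthMatrix p z * diagMatrix _ * lengthMatrix p z⁻¹
      ext i j
      rw [mul_lengthMatrix_apply, lengthMatrix_mul_apply]
      by_cases hij : i = j
      · subst hij
        rw [mul_right_comm, ← mul_pow, ← Circle.coe_mul, mul_inv_cancel, Circle.coe_one, one_pow,
          one_mul]
      · simp [diagMatrix, hij]
    · change (z : ℂ) • consMatrix p e = lengthMatrix p z * consMatrix p e * lengthMatrix p z⁻¹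
      ext i j
      rw [mul_lengthMatrix_apply, lengthMatrix_mul_apply, CStarMatrix.smul_apply]
      by_cases hij : (p i).1.2 = e :: (p j).1.2
      · rw [mul_right_comm, hij, List.length_cons, pow_succ', mul_assoc (z : ℂ), ← mul_pow,
          ← Circle.coe_mul, mul_inv_cancel, Circle.coe_one, one_pow, mul_one, smul_eq_mul]
      · simp [consMatrix, hij]
  exact DFunLike.congr_fun h x

/-- If the restriction of the gauge action to `ℤ/k` has a free partition, then the nontrivial
length matrices have trace `0`. -/
theorem sum_pow_length_eq_zero [Finite V] (hb : E.IsSink b) {k : ℕ} [NeZero k]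
    (h : HasFreePartition fun g => (CStar.cyclicGauge.{u, v, w} E k g : CStar.{u, v, w} E → _))
    {m : ZMod k} (hm : m ≠ 0) :
    ∑ i, ((ZMod.toCircle m : Circle) : ℂ) ^ (p i).1.2.length = 0 := by
  obtain ⟨κ, _, c, h1, h2⟩ := h
  let π := CStar.lift (pathFamily p hb)
  let z : Circle := ZMod.toCircle m
  have hc : ∀ i, π (c i) * lengthMatrix p z * π (c i) = 0 := by
    intro i
    -- Acting by `-m` conjugates as `L(z⁻¹) · L(z)`; once the left factor is cancelled, precisely
    -- `L(z)` stands between the two copies of `π (c i)`.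
    have h3 := h2 i (Multiplicative.ofAdd (-m)) (by simpa using hm)
    have h4 : CStar.gauge E z⁻¹ (c i) * c i = 0 := by
      rw [← AddChar.map_neg_eq_inv]
      exact h3
    have h5 := congrArg π h4
    rw [map_mul, map_zero, lift_pathFamily_gauge, inv_inv] at h5
    have h6 := congrArg (lengthMatrix p z * ·) h5
    simp only [mul_zero, ← mul_assoc, lengthMatrix_mul, mul_inv_cancel, lengthMatrix_one,
      one_mul] at h6
    exact h6
  let tr : CStarMatrix ι ι ℂ →+ ℂ :=
    { toFun := fun M => Matrix.trace (CStarMatrix.ofMatrix.symm M)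
      map_zero' := Matrix.trace_zero _ _
      map_add' := Matrix.trace_add }
  have htr : ∀ M N : CStarMatrix ι ι ℂ, tr (M * N) = tr (N * M) := fun M N =>
    Matrix.trace_mul_comm (CStarMatrix.ofMatrix.symm M) (CStarMatrix.ofMatrix.symm N)
  have h7 : tr (lengthMatrix p z) = ∑ i, (z : ℂ) ^ (p i).1.2.length := Matrix.trace_diagonal _
  have h8 : ∑ i, π (c i) * π (c i) = 1 := by
    rw [← lift_pathFamily_one p hb, ← h1, map_sum]
    exact Finset.sum_congr rfl fun i _ => (map_mul π _ _).symm
  -- Inserting `1 = ∑ π (c i) * π (c i)` and cycling one factor under the trace turns every summand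
  -- into the trace of a product that vanishes by `hc`.
  rw [← h7, ← mul_one (lengthMatrix p z), ← h8, Finset.mul_sum, map_sum]
  refine Finset.sum_eq_zero fun i _ => ?_
  rw [← mul_assoc, htr, ← mul_assoc, hc, map_zero]

end PathRepresentation

/-- If the restriction of the gauge action to `ℤ/k` has a free partition, then the numbers of paths
that end at a given sink and have a given length modulo `k` are equal. -/
theorem pathCount_eq_of_hasFreePartition {V : Type u} {Ed : Type v} [Finite V] [Finite Ed]
    {E : DirectedGraph V Ed} (hE : E.IsAcyclic) {k : ℕ} [NeZero k]
    (h : HasFreePartition fun g => (CStar.cyclicGauge.{u, v, w} E k g : CStar.{u, v, w} E → _))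
    {b : V} (hb : E.IsSink b) (i j : ZMod k) : E.pathCount k b i = E.pathCount k b j := by
  classical
  have := hE.finite_pathTo b
  have := Fintype.ofFinite (E.PathTo b)
  -- `CStar.lift` only reaches algebras in the universe `w`, whereas the paths live in another one;
  -- hence the lifted copy of `Fin` as index set of the matrices.
  let p : ULift.{w} (Fin (Nat.card (E.PathTo b))) ≃ E.PathTo b :=
    Equiv.ulift.trans (Finite.equivFin _).symm
  have h1 := fun m hm => sum_pow_length_eq_zero p hb h (m := m) hm
  -- Grouping the diagonal entries by path length modulo `k` identifies the trace with a Fourier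
  -- coefficient of the path count.
  have key : ∀ m : ZMod k, m ≠ 0 →
      ∑ i, (E.pathCount k b i : ℂ) * ZMod.stdAddChar (m * i) = 0 := by
    intro m hm
    rw [← h1 m hm, Fintype.sum_equiv p _
      (fun x => ZMod.stdAddChar (m * (x.1.2.length : ZMod k))) fun x => ?_,
      ← Finset.sum_fiberwise Finset.univ fun x : E.PathTo b => (x.1.2.length : ZMod k)]
    · refine Finset.sum_congr rfl fun i _ => ?_
      rw [Finset.sum_congr rfl (g := fun _ => ZMod.stdAddChar (m * i))]
      · rw [Finset.sum_const, nsmul_eq_mul, pathCount_eq_card, Nat.card_eq_fintype_card,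
          Fintype.card_subtype]
      · intro x hx
        rw [(Finset.mem_filter.mp hx).2]
    · rw [← ZMod.stdAddChar_apply, ← AddChar.map_nsmul_eq_pow, nsmul_eq_mul, mul_comm]
  exact_mod_cast ZMod.eq_of_sum_mul_stdAddChar_eq_zero _ key i j

end DirectedGraph

/-! ### Actions of cyclic groups with a unitary generator of the dual action -/

section CyclicAction

variable {k : ℕ} [NeZero k] {A : Type v} [CStarAlgebra A]

/-- The spectral projections of a unitary representation `U` of `ℤ/k`. -/
noncomputable def spectralProj (U : ZMod k → A) (h : ZMod k) : A :=
  (k : ℂ)⁻¹ • ∑ j, (ZMod.stdAddChar (-(h * j)) : ℂ) • U j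

variable {U : ZMod k → A}

theorem mul_spectralProj (hU : ∀ i j, U i * U j = U (i + j)) (i h : ZMod k) :
    U i * spectralProj U h = (ZMod.stdAddChar (h * i) : ℂ) • spectralProj U h := by
  rw [spectralProj, mul_smul_comm, smul_comm, Finset.mul_sum,
    Finset.smul_sum (r := (ZMod.stdAddChar (h * i) : ℂ))]
  refine congrArg _ (Fintype.sum_equiv (Equiv.addLeft i) _ _ fun j => ?_)
  rw [mul_smul_comm, hU, smul_smul, ← AddChar.map_add_eq_mul, Equiv.coe_addLeft]
  congr 2
  ring

/-- Each `U j` acts on the second factor as a scalar, so the product is that factor times a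
character sum, and orthogonality of characters finishes. -/
theorem spectralProj_mul_spectralProj (hU : ∀ i j, U i * U j = U (i + j)) (h h' : ZMod k) :
    spectralProj U h * spectralProj U h' = if h = h' then spectralProj U h' else 0 := by
  rw [spectralProj, smul_mul_assoc, Finset.sum_mul]
  simp_rw [smul_mul_assoc, mul_spectralProj hU, smul_smul, ← AddChar.map_add_eq_mul]
  have h1 : ∀ j, -(h * j) + h' * j = j * (h' - h) := fun j => by ring
  simp_rw [h1, ← Finset.sum_smul, AddChar.sum_mulShift _ (ZMod.isPrimitive_stdAddChar k),
    ZMod.card, sub_eq_zero, eq_comm (a := h')]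
  split_ifs
  · rw [smul_smul, inv_mul_cancel₀ (Nat.cast_ne_zero.mpr (NeZero.ne k)), one_smul]
  · simp

theorem sum_spectralProj (h0 : U 0 = 1) : ∑ h, spectralProj U h = 1 := by
  simp_rw [spectralProj, ← Finset.smul_sum]
  rw [Finset.sum_comm]
  have h1 : ∀ h j : ZMod k, -(h * j) = h * -j := fun h j => by ring
  simp_rw [h1, ← Finset.sum_smul, AddChar.sum_mulShift _ (ZMod.isPrimitive_stdAddChar k),
    ZMod.card, neg_eq_zero]
  rw [Finset.sum_eq_single 0]
  · rw [if_pos rfl, smul_smul, inv_mul_cancel₀ (Nat.cast_ne_zero.mpr (NeZero.ne k)), one_smul, h0]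
  · intro j _ hj
    simp [hj]
  · simp

theorem star_spectralProj (hs : ∀ j, star (U j) = U (-j)) (h : ZMod k) :
    star (spectralProj U h) = spectralProj U h := by
  rw [spectralProj, star_smul, star_sum]
  congr 1
  · simp
  · refine Fintype.sum_equiv (Equiv.neg _) _ _ fun j => ?_
    rw [star_smul, hs, Equiv.neg_apply, mul_neg, neg_neg]
    congr 1
    rw [AddChar.map_neg_eq_conj]
    exact Complex.conj_conj _

/-- If the dual action of `ℤ/k` is implemented by unitaries in the algebra, then the action has
strong local-triviality dimension `0`. -/
theorem hasStrongLT_zero_of_dual (α : Multiplicative (ZMod k) →* (A ≃⋆ₐ[ℂ] A)) (h0 : U 0 = 1)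
    (hU : ∀ i j, U i * U j = U (i + j)) (hs : ∀ j, star (U j) = U (-j))
    (hα : ∀ g j, α (Multiplicative.ofAdd g) (U j) = (ZMod.stdAddChar (g * j) : ℂ) • U j) :
    HasStrongLT (Multiplicative (ZMod k)) α 0 := by
  let ev (h : ZMod k) (f : C(EnSpace (Multiplicative (ZMod k)) 0, ℂ)) : ℂ :=
    f (show Multiplicative (ZMod k) from Multiplicative.ofAdd h)
  refine ⟨
    { toFun := fun f => ∑ h, ev h f • spectralProj U h
      map_one' := ?_
      map_mul' := fun f f' => ?_
      map_zero' := ?_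
      map_add' := fun f f' => ?_
      commutes' := fun c => ?_
      map_star' := fun f => ?_ }, fun g f => ?_⟩
  · change ∑ h, (1 : ℂ) • spectralProj U h = 1
    simp_rw [one_smul]
    exact sum_spectralProj h0
  · change ∑ h, (ev h f * ev h f') • spectralProj U h = _
    simp_rw [Finset.sum_mul, Finset.mul_sum, smul_mul_smul_comm,
      spectralProj_mul_spectralProj hU, smul_ite, smul_zero]
    simp
  · change ∑ h, (0 : ℂ) • spectralProj U h = 0
    simp
  · change ∑ h, (ev h f + ev h f') • spectralProj U h = _
    simp_rw [add_smul, Finset.sum_add_distrib]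
  · change ∑ h, c • spectralProj U h = _
    rw [← Finset.smul_sum, sum_spectralProj h0, Algebra.algebraMap_eq_smul_one]
  · change ∑ h, star (ev h f) • spectralProj U h = star (∑ h, ev h f • spectralProj U h)
    rw [star_sum]
    exact Finset.sum_congr rfl fun h _ => by rw [star_smul, star_spectralProj hs]
  -- By `hα`, the automorphism `α g` carries the spectral projection at `h + g` to the one at `h`,
  -- which is the effect of right translation on point masses.
  · change ∑ h, ev (h + g.toAdd) f • spectralProj U h = α g (∑ h, ev h f • spectralProj U h)
    rw [map_sum]
    refine Fintype.sum_equiv (Equiv.addRight g.toAdd) _ _ fun h => ?_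
    rw [map_smul, Equiv.coe_addRight]
    congr 1
    rw [spectralProj, spectralProj, map_smul, map_sum]
    congr 1
    refine Finset.sum_congr rfl fun j _ => ?_
    rw [map_smul, ← ofAdd_toAdd g, hα, smul_smul, ← AddChar.map_add_eq_mul, ofAdd_toAdd]
    congr 2
    ring

end CyclicAction

namespace DirectedGraph

/-! ### The partial isometries of paths -/

namespace CuntzKriegerFamily

variable {V : Type u} {Ed : Type v} {E : DirectedGraph V Ed} {B : Type w}
  [NonUnitalCStarAlgebra B] (F : E.CuntzKriegerFamily B)

theorem P_mul_S (e : Ed) : F.P (E.s e) * F.S e = F.S e := by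
  rw [← F.partialIsometry_S e, ← mul_assoc, F.range_le]

theorem P_mul_S_of_ne {a : V} {e : Ed} (h : a ≠ E.s e) : F.P a * F.S e = 0 := by
  rw [← F.P_mul_S, ← mul_assoc, F.P_orthogonal _ _ h, zero_mul]

theorem P_mul_star_S (e : Ed) : F.P (E.r e) * star (F.S e) = star (F.S e) := by
  have h := congrArg star (F.partialIsometry_S e)
  rwa [star_mul, star_mul, star_star, ← mul_assoc, F.star_S_mul_S] at h

/-- Multiplying the orthogonality of the range projections by `S_e⋆` on the left and `S_f` on the
right collapses it, since both are partial isometries. -/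
theorem star_S_mul_S_of_ne {e f : Ed} (h : e ≠ f) : star (F.S e) * F.S f = 0 := by
  have h1 := congrArg (fun x => star (F.S e) * x * F.S f) (F.ranges_orthogonal e f h)
  simp only [mul_zero, zero_mul, ← mul_assoc] at h1
  rwa [F.star_S_mul_S, F.P_mul_star_S, mul_assoc, mul_assoc, ← mul_assoc (F.S f),
    F.partialIsometry_S] at h1

/-- The partial isometry of a path that ends at `b`. -/
def pathIso (b : V) : List Ed → B
  | [] => F.P b
  | e :: l => F.S e * pathIso b l

theorem P_mul_pathIso {a b : V} {l : List Ed} (h : E.IsPath a l b) :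
    F.P a * F.pathIso b l = F.pathIso b l := by
  cases l with
  | nil =>
    cases h
    exact (F.isStarProjection_P a).isIdempotentElem.eq
  | cons e l =>
    rw [pathIso, ← mul_assoc, ← h.1, F.P_mul_S]

theorem pathIso_mul_P (b : V) (l : List Ed) : F.pathIso b l * F.P b = F.pathIso b l := by
  induction l with
  | nil => exact (F.isStarProjection_P b).isIdempotentElem.eq
  | cons e l ih => rw [pathIso, mul_assoc, ih]

theorem star_pathIso_mul_self {a b : V} {l : List Ed} (h : E.IsPath a l b) :
    star (F.pathIso b l) * F.pathIso b l = F.P b := by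
  induction l generalizing a with
  | nil =>
    rw [pathIso, (F.isStarProjection_P b).isSelfAdjoint.star_eq,
      (F.isStarProjection_P b).isIdempotentElem.eq]
  | cons e l ih =>
    rw [pathIso, star_mul, mul_assoc, ← mul_assoc _ (F.S e), F.star_S_mul_S,
      F.P_mul_pathIso h.2, ih h.2]

/-- A path that ends at a sink cannot be prolonged, so neither of two distinct such paths is an
initial segment of the other. After their common part is cancelled, either two distinct edges, an
edge and a sink, or two distinct sinks meet, and the product dies. -/
theorem star_pathIso_mul_of_ne {a a' b b' : V} {l l' : List Ed} (hb : E.IsSink b)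
    (hb' : E.IsSink b') (h : E.IsPath a l b) (h' : E.IsPath a' l' b')
    (hne : ¬(b = b' ∧ l = l')) : star (F.pathIso b l) * F.pathIso b' l' = 0 := by
  induction l generalizing a a' l' with
  | nil =>
    rw [pathIso, (F.isStarProjection_P b).isSelfAdjoint.star_eq]
    cases l' with
    | nil => exact F.P_orthogonal _ _ fun hh => hne ⟨hh, rfl⟩
    | cons e l' => rw [pathIso, ← mul_assoc, F.P_mul_S_of_ne (hb e).symm, zero_mul]
  | cons e l ih =>
    cases l' with
    | nil =>
      have h1 := congrArg star (F.P_mul_S_of_ne (hb' e).symm)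
      rw [star_mul, (F.isStarProjection_P b').isSelfAdjoint.star_eq, star_zero] at h1
      rw [pathIso, pathIso, star_mul, mul_assoc, h1, mul_zero]
    | cons f l' =>
      rw [pathIso, pathIso, star_mul, mul_assoc, ← mul_assoc _ (F.S f)]
      by_cases hef : e = f
      · subst hef
        rw [F.star_S_mul_S, F.P_mul_pathIso h'.2]
        exact ih h.2 h'.2 fun hh => hne ⟨hh.1, by rw [hh.2]⟩
      · rw [F.star_S_mul_S_of_ne hef, zero_mul, mul_zero]

/-- Expanding `P_a = ∑ S_e S_e⋆` again and again stops at the sinks, so `P_a` is the sum of `S_l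
S_l⋆` over the paths `l` from `a` to sinks. Stating this as a vanishing test avoids writing that
sum. -/
theorem P_mul_eq_zero [Finite V] [Finite Ed] (hE : E.IsAcyclic) {a : V} {z : B}
    (hz : ∀ b l, E.IsSink b → E.IsPath a l b → star (F.pathIso b l) * z = 0) :
    F.P a * z = 0 := by
  induction a using hE.wellFounded.induction generalizing z with
  | _ a ih =>
    by_cases ha : E.IsSink a
    · have h1 := hz a [] ha rfl
      rwa [pathIso, (F.isStarProjection_P a).isSelfAdjoint.star_eq] at h1
    · have hne : {e : Ed | E.s e = a}.Nonempty := by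
        by_contra h
        exact ha fun e he => h ⟨e, he⟩
      rw [F.P_eq_sum a (Set.toFinite _) hne, Finset.sum_mul]
      refine Finset.sum_eq_zero fun e he => ?_
      rw [Set.Finite.mem_toFinset] at he
      -- A vertex projection is put back in front of `S_e⋆`, so that the induction hypothesis
      -- applies with `S_e⋆ z` in place of `z`.
      rw [mul_assoc, ← F.P_mul_star_S, mul_assoc, ih (E.r e) ⟨e, he, rfl⟩, mul_zero]
      intro b l hb hl
      have h1 := hz b (e :: l) hb ⟨he, hl⟩
      rwa [pathIso, star_mul, mul_assoc] at h1

end CuntzKriegerFamily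

/-! ### Partial isometries of paths to sinks and the unitaries built from them -/

namespace CStar

variable {V : Type u} {Ed : Type v} {E : DirectedGraph V Ed}

/-- The partial isometry in `C⋆(E)` of a path that ends at a sink. -/
noncomputable def sinkIso (x : E.SinkPath) : CStar.{u, v, w} E :=
  canonicalFamily.pathIso x.1.1 x.2.1.2

theorem star_sinkIso_mul_self (x : E.SinkPath) :
    star (sinkIso.{u, v, w} x) * sinkIso x = vertexProj E x.1.1 :=
  canonicalFamily.star_pathIso_mul_self x.2.2

theorem star_sinkIso_mul_of_ne {x y : E.SinkPath} (h : x ≠ y) :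
    star (sinkIso.{u, v, w} x) * sinkIso y = 0 := by
  refine canonicalFamily.star_pathIso_mul_of_ne x.1.2 y.1.2 x.2.2 y.2.2 fun hh => h ?_
  obtain ⟨⟨b, hb⟩, x⟩ := x
  obtain ⟨⟨b', hb'⟩, y⟩ := y
  obtain ⟨rfl, hl⟩ := hh
  exact congrArg (Sigma.mk _) (pathTo_ext hl)

theorem sinkIso_mul_vertexProj (x : E.SinkPath) :
    sinkIso.{u, v, w} x * vertexProj E x.1.1 = sinkIso x :=
  canonicalFamily.pathIso_mul_P _ _

theorem gaugeHom_pathIso (z : Circle) (b : V) (l : List Ed) :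
    gaugeHom.{u, v, w} E z (canonicalFamily.pathIso b l) =
      (z : ℂ) ^ l.length • canonicalFamily.pathIso b l := by
  induction l with
  | nil => rw [List.length_nil, pow_zero, one_smul]; rfl
  | cons e l ih =>
    rw [CuntzKriegerFamily.pathIso, map_mul, ih, List.length_cons, pow_succ',
      ← smul_mul_smul_comm]
    rfl

variable [Finite V] [Finite Ed]

/-- Orthogonality shows that every `S_x⋆` annihilates the difference of `1` and the sum from the
left; `P_mul_eq_zero` then makes every vertex projection annihilate it, hence so does the unit. -/
theorem sum_sinkIso_mul_star (hE : E.IsAcyclic) [Fintype E.SinkPath] :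
    ∑ x, sinkIso.{u, v, w} x * star (sinkIso x) = (1 : CStar.{u, v, w} E) := by
  classical
  let q : CStar.{u, v, w} E := ∑ x, sinkIso.{u, v, w} x * star (sinkIso x)
  have hq : ∀ x, star (sinkIso.{u, v, w} x) * q = star (sinkIso x) := by
    intro x
    have h := congrArg star (sinkIso_mul_vertexProj.{u, v, w} x)
    have hv : star (vertexProj.{u, v, w} E x.1.1) = vertexProj E x.1.1 :=
      (canonicalFamily.isStarProjection_P x.1.1).isSelfAdjoint.star_eq
    rw [star_mul, hv] at h
    rw [Finset.mul_sum, Finset.sum_eq_single x]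
    · rw [← mul_assoc, star_sinkIso_mul_self, h]
    · intro y _ hy
      rw [← mul_assoc, star_sinkIso_mul_of_ne hy.symm, zero_mul]
    · simp
  have hP : ∀ a, vertexProj.{u, v, w} E a * (unit E - q) = 0 := by
    intro a
    refine canonicalFamily.P_mul_eq_zero hE fun b l hb hl => ?_
    have h := hq ⟨⟨b, hb⟩, ⟨(a, l), hl⟩⟩
    rw [mul_sub, mul_unit, sub_eq_zero]
    exact h.symm
  have h1 : unit.{u, v, w} E * (unit E - q) = 0 := by
    nth_rw 1 [unit]
    rw [Finset.sum_mul]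
    exact Finset.sum_eq_zero fun a _ => hP a
  rw [unit_mul, sub_eq_zero] at h1
  exact h1.symm

/-- If for each sink the numbers of paths that end there do not depend on the length modulo `k`,
then the action of `ℤ/k` has strong local-triviality dimension `0`. -/
theorem hasStrongLT_zero (hE : E.IsAcyclic) (k : ℕ) [NeZero k]
    (h : ∀ a : V, E.IsSink a → ∀ i j : ZMod k, E.pathCount k a i = E.pathCount k a j) :
    HasStrongLT _ (cyclicGauge.{u, v, w} E k) 0 := by
  classical
  have hfin := hE.finite_pathTo
  have := Fintype.ofFinite E.SinkPath
  have hT := fun b : {b : V // E.IsSink b} =>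
    exists_shift (fun x : E.PathTo b.1 => (x.1.2.length : ZMod k)) fun i j => by
      rw [← pathCount_eq_card, ← pathCount_eq_card, h b.1 b.2 i j]
  choose T hT0 hTT hTl using hT
  -- `U j` is the permutation matrix of the shift `T j`, written in the matrix units of paths to
  -- sinks.
  let U (j : ZMod k) : CStar.{u, v, w} E :=
    ∑ x : E.SinkPath, sinkIso ⟨x.1, T x.1 j x.2⟩ * star (sinkIso x)
  have hU : ∀ i j, U i * U j = U (i + j) := by
    intro i j
    simp_rw [U, Finset.mul_sum]
    refine Finset.sum_congr rfl fun y _ => ?_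
    rw [Finset.sum_mul, Finset.sum_eq_single ⟨y.1, T y.1 j y.2⟩]
    · rw [mul_assoc, ← mul_assoc (star _), star_sinkIso_mul_self, ← mul_assoc, hTT, add_comm j i]
      congr 1
      exact sinkIso_mul_vertexProj ⟨y.1, T y.1 (i + j) y.2⟩
    · intro x _ hx
      rw [mul_assoc, ← mul_assoc (star _), star_sinkIso_mul_of_ne hx, zero_mul, mul_zero]
    · simp
  have hs : ∀ j, star (U j) = U (-j) := by
    intro j
    rw [star_sum]
    -- The adjoint sends `T j x` back to `x`; reindexing by this bijection brings it to the form of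
    -- `U (-j)`.
    let e : E.SinkPath ≃ E.SinkPath :=
      { toFun := fun x => ⟨x.1, T x.1 j x.2⟩
        invFun := fun x => ⟨x.1, T x.1 (-j) x.2⟩
        left_inv := fun x => by simp [hTT, hT0]
        right_inv := fun x => by simp [hTT, hT0] }
    refine Fintype.sum_equiv e _ _ fun x => ?_
    rw [star_mul, star_star]
    congr 2
    exact (e.left_inv x).symm
  refine hasStrongLT_zero_of_dual (U := U) _ ?_ hU hs fun g j => ?_
  · rw [← sum_sinkIso_mul_star hE]
    exact Finset.sum_congr rfl fun x _ => by rw [hT0]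
  · let z : Circle := ZMod.toCircle g
    have hz : ∀ n : ℕ, (z : ℂ) ^ n = ZMod.stdAddChar (g * (n : ZMod k)) := fun n => by
      rw [← ZMod.stdAddChar_apply, ← AddChar.map_nsmul_eq_pow, nsmul_eq_mul, mul_comm]
    change gaugeHom E z (U j) = _
    rw [map_sum, Finset.smul_sum]
    refine Finset.sum_congr rfl fun x _ => ?_
    -- The summand at `x` is scaled by `z` to the difference of the two path lengths. That
    -- difference is `j` modulo `k` and `z` is a `k`-th root of unity, so the factor is the same for
    -- every `x`.
    rw [map_mul, map_star, sinkIso, sinkIso, gaugeHom_pathIso, gaugeHom_pathIso, star_smul,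
      smul_mul_smul_comm, hz, hz, hTl, mul_add, AddChar.map_add_eq_mul]
    congr 1
    have h1 : (ZMod.stdAddChar (g * (x.2.1.2.length : ZMod k)) : ℂ) *
        star (ZMod.stdAddChar (g * (x.2.1.2.length : ZMod k)) : ℂ) = 1 := by
      rw [ZMod.stdAddChar_apply]
      exact (Complex.mul_conj' _).trans (by rw [Circle.norm_coe]; simp)
    rw [mul_right_comm, h1, one_mul]

end CStar

end DirectedGraph

/-! ### Finiteness and vanishing of the dimensions, and the equivalence -/

theorem plainLTDim_lt_top_iff {G : Type u} [TopologicalSpace G] [Group G] [IsTopologicalGroup G]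
    [CompactSpace G] {A : Type v} [CStarAlgebra A] (α : G →* (A ≃⋆ₐ[ℂ] A)) :
    plainLTDim G α < ⊤ ↔ ∃ n, HasPlainLT G α n := by
  simp [plainLTDim, iInf_lt_iff]

theorem strongLTDim_lt_top_iff {G : Type u} [TopologicalSpace G] [Group G] [IsTopologicalGroup G]
    [CompactSpace G] {A : Type v} [CStarAlgebra A] (α : G →* (A ≃⋆ₐ[ℂ] A)) :
    strongLTDim G α < ⊤ ↔ ∃ n, HasStrongLT G α n := by
  simp [strongLTDim, iInf_lt_iff]

theorem HasPlainLT.plainLTDim_eq_zero {G : Type u} [TopologicalSpace G] [Group G]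
    [IsTopologicalGroup G] [CompactSpace G] {A : Type v} [CStarAlgebra A]
    {α : G →* (A ≃⋆ₐ[ℂ] A)} (h : HasPlainLT G α 0) : plainLTDim G α = 0 :=
  le_antisymm (iInf₂_le 0 h) bot_le

theorem HasStrongLT.strongLTDim_eq_zero {G : Type u} [TopologicalSpace G] [Group G]
    [IsTopologicalGroup G] [CompactSpace G] {A : Type v} [CStarAlgebra A]
    {α : G →* (A ≃⋆ₐ[ℂ] A)} (h : HasStrongLT G α 0) : strongLTDim G α = 0 :=
  le_antisymm (iInf₂_le 0 h) bot_le

theorem mainTheorem2 {V : Type u} {Ed : Type v} [Finite V] [Finite Ed]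
    (E : DirectedGraph V Ed) (hE : E.IsAcyclic) (k : ℕ) [NeZero k] :
    List.TFAE
      [strongLTDim _ (DirectedGraph.CStar.cyclicGauge.{u, v, w} E k) < ⊤,
        plainLTDim _ (DirectedGraph.CStar.cyclicGauge.{u, v, w} E k) < ⊤,
        ∀ a : V, E.IsSink a → ∀ i j : ZMod k, E.pathCount k a i = E.pathCount k a j,
        plainLTDim _ (DirectedGraph.CStar.cyclicGauge.{u, v, w} E k) = 0] ∧
    (strongLTDim _ (DirectedGraph.CStar.cyclicGauge.{u, v, w} E k) = 0 ∨
      strongLTDim _ (DirectedGraph.CStar.cyclicGauge.{u, v, w} E k) = ⊤) ∧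
    (plainLTDim _ (DirectedGraph.CStar.cyclicGauge.{u, v, w} E k) = 0 ∨
      plainLTDim _ (DirectedGraph.CStar.cyclicGauge.{u, v, w} E k) = ⊤) := by
  have h13 : strongLTDim _ (DirectedGraph.CStar.cyclicGauge.{u, v, w} E k) < ⊤ →
      ∀ a : V, E.IsSink a → ∀ i j : ZMod k, E.pathCount k a i = E.pathCount k a j := by
    intro h a ha
    obtain ⟨n, hn⟩ := (strongLTDim_lt_top_iff _).mp h
    exact DirectedGraph.pathCount_eq_of_hasFreePartition hE hn.hasFreePartition ha
  have h23 : plainLTDim _ (DirectedGraph.CStar.cyclicGauge.{u, v, w} E k) < ⊤ →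
      ∀ a : V, E.IsSink a → ∀ i j : ZMod k, E.pathCount k a i = E.pathCount k a j := by
    intro h a ha
    obtain ⟨n, hn⟩ := (plainLTDim_lt_top_iff _).mp h
    exact DirectedGraph.pathCount_eq_of_hasFreePartition hE hn.hasFreePartition ha
  have h3s : (∀ a : V, E.IsSink a → ∀ i j : ZMod k, E.pathCount k a i = E.pathCount k a j) →
      strongLTDim _ (DirectedGraph.CStar.cyclicGauge.{u, v, w} E k) = 0 := fun h =>
    (DirectedGraph.CStar.hasStrongLT_zero hE k h).strongLTDim_eq_zero
  have h3p : (∀ a : V, E.IsSink a → ∀ i j : ZMod k, E.pathCount k a i = E.pathCount k a j) →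
      plainLTDim _ (DirectedGraph.CStar.cyclicGauge.{u, v, w} E k) = 0 := fun h =>
    (DirectedGraph.CStar.hasStrongLT_zero hE k h).hasPlainLT_zero.plainLTDim_eq_zero
  refine ⟨?_, ?_, ?_⟩
  · tfae_have 1 → 3 := h13
    tfae_have 2 → 3 := h23
    tfae_have 3 → 4 := h3p
    tfae_have 4 → 2 := fun h => h ▸ ENat.top_pos
    tfae_have 3 → 1 := fun h => h3s h ▸ ENat.top_pos
    tfae_finish
  · exact or_iff_not_imp_right.mpr fun h => h3s (h13 (lt_top_iff_ne_top.mpr h))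
  · exact or_iff_not_imp_right.mpr fun h => h3p (h23 (lt_top_iff_ne_top.mpr h))
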